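/- For a probability measure $\mu$ on $\mathbb{R}^2$ let $L_\mu(\theta)=\int e^{\langle\theta,x\rangle}\,\mu(dx)$, let $\Theta(\mu)$ be the interior of $\{\theta\in\mathbb{R}^2: L_\mu(\theta)<\infty\}$, let $k_\mu=\log L_\mu$, and, if $\Theta(\mu)\neq\emptyset$, let $V$ be the variance function of the natural exponential family generated by $\mu$, that is, $V(k_\mu'(\theta))=k_\mu''(\theta)$ for $\theta\in\Theta(\mu)$. **Theorem.** Let $\mu$ be a probability measure on $\mathbb{R}^2$, not concentrated in a point, with $\Theta(\mu)\ne\emptyset$, and let $A,a,b,c,d,e,f$ be real numbers with $A<0$ and $b\neq 0$. Suppose that for all $m=(m_1,m_2)\in k_\mu'(\Theta(\mu))$ $$\operatorname{diag}V(m_1,m_2)=\left(Am_1^2+am_1+bm_2+e,\;Am_2^2+cm_1+dm_2+f\right).$$ Let $\lambda_1,\dots,\lambda_{n_r}$ be the distinct real roots of $$\lambda^4-2a\lambda^3+(2Ae+a^2-db)\lambda^2-(2Aae-adb+cb^2)\lambda+A^2e^2-edbA+fb^2A=0.$$ Then $n_r\ge 2$, and there are real numbers $\alpha_1,\dots,\alpha_{n_r}$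 such that $$L_\mu(\theta_1,\theta_2)=\left(\sum_{i=1}^{n_r}\alpha_i\exp\left(\lambda_i\theta_1+\frac{\lambda_i^2-a\lambda_i+eA}{b}\,\theta_2\right)\right)^{-1/A},\qquad(\theta_1,\theta_2)\in\Theta(\mu).$$ Moreover, for all real $\alpha_1,\dots,\alpha_{n_r}$ for which this identity holds, either * $\alpha_i\ge 0$ for all $i$, $\sum_i\alpha_i=1$, $-1/A\in\mathbb{N}$ and $\Theta(\mu)=\mathbb{R}^2$, or * $\alpha_i\le 0$ for all $i$, $\sum_i\alpha_i=-1$, $-1/A\in2\mathbb{N}$ and $\Theta(\mu)=\mathbb{R}^2$. -/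

import Mathlib

open MeasureTheory
open scoped RealInnerProductSpace

noncomputable section

namespace NEF

variable {n : ℕ}

/-- The Laplace transform `L_μ(θ) = ∫ exp⟨θ, x⟩ μ(dx)`; it is meaningful where the integrand is
integrable, see `laplaceDomain`. -/
def laplace (μ : Measure (EuclideanSpace ℝ (Fin n))) (θ : EuclideanSpace ℝ (Fin n)) : ℝ :=
  ∫ x, Real.exp ⟪θ, x⟫ ∂μ

/-- `Θ(μ)`, the interior of the set of all `θ` at which the Laplace transform is finite. -/
def laplaceDomain (μ : Measure (EuclideanSpace ℝ (Fin n))) : Set (EuclideanSpace ℝ (Fin n)) :=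
  interior {θ | Integrable (fun x => Real.exp ⟪θ, x⟫) μ}

/-- The cumulant function `k_μ = log L_μ`. -/
def cumulant (μ : Measure (EuclideanSpace ℝ (Fin n))) (θ : EuclideanSpace ℝ (Fin n)) : ℝ :=
  Real.log (laplace μ θ)

/-- The Hessian matrix of second partial derivatives of a function on `ℝⁿ`. -/
def hessian (g : EuclideanSpace ℝ (Fin n) → ℝ) (θ : EuclideanSpace ℝ (Fin n)) :
    Matrix (Fin n) (Fin n) ℝ :=
  Matrix.of fun i j =>
    fderiv ℝ (fun η => fderiv ℝ g η (EuclideanSpace.single j 1)) θ (EuclideanSpace.single i 1)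

/-- The domain of means `M_F`, the image of `Θ(μ)` under `k_μ'`. -/
def meanDomain (μ : Measure (EuclideanSpace ℝ (Fin n))) : Set (EuclideanSpace ℝ (Fin n)) :=
  gradient (cumulant μ) '' laplaceDomain μ

/-- The inverse `Ψ_μ` of `k_μ' : Θ(μ) → M_F`. (When `μ` is carried by an affine hyperplane, `k_μ'`
is not injective and this selects some preimage; all preimages of a mean give the same
exponentially tilted probability, hence the same value of `k_μ''`.) -/
def meanInverse (μ : Measure (EuclideanSpace ℝ (Fin n))) :
    EuclideanSpace ℝ (Fin n) → EuclideanSpace ℝ (Fin n) :=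
  Function.invFunOn (gradient (cumulant μ)) (laplaceDomain μ)

/-- The variance function `V_F(m) = k_μ''(Ψ_μ(m))`, to be used for `m` in the domain of means. -/
def varianceFunction (μ : Measure (EuclideanSpace ℝ (Fin n))) (m : EuclideanSpace ℝ (Fin n)) :
    Matrix (Fin n) (Fin n) ℝ :=
  hessian (cumulant μ) (meanInverse μ m)

open Polynomial in
/-- The quartic polynomial attached to the coefficients of the diagonal of the variance function. -/
def quartic (A a b c d e f : ℝ) : ℝ[X] :=
  X ^ 4 - C (2 * a) * X ^ 3 + C (2 * A * e + a ^ 2 - d * b) * X ^ 2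
    - C (2 * A * a * e - a * d * b + c * b ^ 2) * X
    + C (A ^ 2 * e ^ 2 - e * d * b * A + f * b ^ 2 * A)

/-- The finite set of distinct real roots of the quartic. -/
def realRoots (A a b c d e f : ℝ) : Finset ℝ :=
  (quartic A a b c d e f).roots.toFinset

/-- `L_μ(θ) = (∑ α_i exp(λ_i θ₁ + ((λ_i² - a λ_i + e A) / b) θ₂)) ^ (-1/A)` on `Θ(μ)`, the sum being
over the distinct real roots `λ_i` of the quartic; the coefficient of the root `l` is `α l`. -/
def HasLaplaceForm (μ : Measure (EuclideanSpace ℝ (Fin 2))) (A a b c d e f : ℝ) (α : ℝ → ℝ) :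
    Prop :=
  ∀ θ ∈ laplaceDomain μ,
    laplace μ θ =
      (∑ l ∈ realRoots A a b c d e f,
        α l * Real.exp (l * θ 0 + (l ^ 2 - a * l + e * A) / b * θ 1)) ^ (-1 / A)

end NEF

end

namespace NEF

open Set Filter Topology

/-! ### Smoothness of the Laplace transform and the variance function as a Hessian. -/

section Smoothness

variable {n : ℕ} {μ : Measure (EuclideanSpace ℝ (Fin n))}

/-! Put g = L_μ^{-A} = exp(-A k_μ). In ∂ᵢ²g = (-A ∂ᵢ²k + A² (∂ᵢk)²) g the quadratic part of the
variance cancels, so the two diagonal conditions become linear equations for g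
(`pde_of_diag_variance`). As b ≠ 0, the first one reads ∂₂g = h(∂₁)g with h(λ) = (λ² - aλ + eA)/b;
inserting this into the second shows that the quartic, read as a polynomial in ∂₁, annihilates g.
Hence g is a finite sum, over the complex roots z, of exp(zθ₁ + h(z)θ₂) times polynomials
(`exists_laplace_representation`).

Such an expression is analytic on the whole plane, and L_μ is a positive power of it. A Laplace
transform that continues analytically past a boundary point of its domain is finite beyond that
point, so Θ(μ) is the plane (`laplaceDomain_eq_univ`).

The frequencies (z, h(z)) lie on a parabola. On the line s ↦ (t + s(2u - a), -bs) the exponent is zt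
- s(z - u)² up to a summand common to all z, so the growth rate is (Im z)² - (Re z - u)². Nonreal
roots of largest |Im z| would dominate for u = Re z and oscillate in t, against g > 0
(`coeff_eq_zero_of_im_ne_zero`). After that, u = z isolates each real root. Positivity for all t,
and the fact that a moment generating function cannot grow like a power, reduce its polynomial
factor to a nonnegative constant (`coeff_nonneg_of_im_eq_zero`).

Since μ is not a point mass, at least two coefficients are positive. Two consecutive ones span an
edge of the convex hull of the frequencies present; restricting μ to the corresponding face gives a
measure with moment generating function (α₁e^{l₁t} + α₂e^{l₂t})^p, p = -1/A. Its complex version is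
entire while the base has a simple complex zero, so p is an order of vanishing, a natural number
(`exists_nat_of_mgf_eq_rpow`). For arbitrary admissible coefficients the sum S satisfies S^p = L_μ >
0, so it has constant sign, and exposedness of points on the parabola gives all coefficients that
sign. -/

theorem isOpen_laplaceDomain : IsOpen (laplaceDomain μ) := isOpen_interior

theorem integrable_of_mem_laplaceDomain {θ : EuclideanSpace ℝ (Fin n)} (h : θ ∈ laplaceDomain μ) :
    Integrable (fun x => Real.exp ⟪θ, x⟫) μ :=
  interior_subset (s := {θ | Integrable (fun x => Real.exp ⟪θ, x⟫) μ}) h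

theorem convex_integrable_exp_inner :
    Convex ℝ {θ : EuclideanSpace ℝ (Fin n) | Integrable (fun x => Real.exp ⟪θ, x⟫) μ} := by
  intro x hx y hy s t hs ht hst
  refine Integrable.mono' ((hx.const_mul s).add (hy.const_mul t))
    (by fun_prop) (Filter.Eventually.of_forall fun z => ?_)
  have := convexOn_exp.2 (Set.mem_univ ⟪x, z⟫) (Set.mem_univ ⟪y, z⟫) hs ht hst
  simpa [inner_add_left, inner_smul_left] using this

theorem convex_laplaceDomain : Convex ℝ (laplaceDomain μ) :=
  convex_integrable_exp_inner.interior

/-- At an interior point of the domain even `exp(⟪θ, x⟫ + δ ‖x‖)` is integrable. -/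
theorem exists_integrable_exp_inner_add_norm {θ : EuclideanSpace ℝ (Fin n)}
    (h : θ ∈ laplaceDomain μ) :
    ∃ δ > (0 : ℝ), Integrable (fun x => Real.exp (⟪θ, x⟫ + δ * ‖x‖)) μ := by
  classical
  obtain ⟨ε, hε, hball⟩ := Metric.isOpen_iff.1 isOpen_laplaceDomain θ h
  -- Pairing x with the vector of its own signs gives the ℓ¹ norm, which is at least ‖x‖; so
  -- finitely many shifts of θ dominate the norm term.
  let v : Finset (Fin n) → EuclideanSpace ℝ (Fin n) :=
    fun S => WithLp.toLp 2 fun i => if i ∈ S then 1 else -1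
  obtain ⟨δ, hδ, hδv⟩ : ∃ δ > (0 : ℝ), ∀ S, ‖δ • v S‖ < ε := by
    have : ∀ᶠ δ in 𝓝[>] (0 : ℝ), ∀ S, ‖δ • v S‖ < ε := by
      rw [Filter.eventually_all]
      intro S
      have : Tendsto (fun δ : ℝ => ‖δ • v S‖) (𝓝[>] 0) (𝓝 ‖(0 : ℝ) • v S‖) :=
        ((Continuous.tendsto (by fun_prop) 0).mono_left nhdsWithin_le_nhds)
      rw [zero_smul, norm_zero] at this
      exact this.eventually (gt_mem_nhds hε)
    obtain ⟨δ, h1, h2⟩ := (this.and self_mem_nhdsWithin).exists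
    exact ⟨δ, h2, h1⟩
  refine ⟨δ, hδ, ?_⟩
  have hint : ∀ S, Integrable (fun x => Real.exp ⟪θ + δ • v S, x⟫) μ := fun S =>
    integrable_of_mem_laplaceDomain (hball (by simpa using hδv S))
  refine Integrable.mono' (integrable_finsetSum Finset.univ fun S _ => hint S)
    (by fun_prop) (Filter.Eventually.of_forall fun x => ?_)
  let S : Finset (Fin n) := Finset.univ.filter fun i => 0 ≤ x i
  have hn : ‖x‖ ≤ ⟪v S, x⟫ := by
    have h1 : ⟪v S, x⟫ = ∑ i, |x i| := by
      rw [PiLp.inner_apply]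
      refine Finset.sum_congr rfl fun i _ => ?_
      by_cases hi : 0 ≤ x i
      · simp [v, S, hi, abs_of_nonneg]
      · simp [v, S, hi, abs_of_neg (not_le.1 hi)]
    rw [h1, EuclideanSpace.norm_eq, Real.sqrt_le_left (Finset.sum_nonneg fun i _ => abs_nonneg _)]
    simpa using Finset.sum_sq_le_sq_sum_of_nonneg (s := Finset.univ) (f := fun i => |x i|)
      fun i _ => abs_nonneg _
  calc ‖Real.exp (⟪θ, x⟫ + δ * ‖x‖)‖ = Real.exp (⟪θ, x⟫ + δ * ‖x‖) := by simp
    _ ≤ Real.exp ⟪θ + δ • v S, x⟫ := by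
      rw [inner_add_left, real_inner_smul_left]; gcongr
    _ ≤ ∑ S, Real.exp ⟪θ + δ • v S, x⟫ :=
      Finset.single_le_sum (f := fun S => Real.exp ⟪θ + δ • v S, x⟫)
        (fun _ _ => (Real.exp_pos _).le) (Finset.mem_univ S)

theorem pow_le_mul_exp {δ : ℝ} (hδ : 0 < δ) (m : ℕ) {y : ℝ} (hy : 0 ≤ y) :
    y ^ m ≤ m.factorial / δ ^ m * Real.exp (δ * y) := by
  have := Real.pow_div_factorial_le_exp (δ * y) (by positivity) m
  rw [div_le_iff₀ (by positivity), mul_pow] at this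
  rw [div_mul_eq_mul_div, le_div_iff₀ (by positivity)]
  linarith

theorem continuous_innerSL_smulRight {E F : Type*} [NormedAddCommGroup E] [InnerProductSpace ℝ E]
    [NormedAddCommGroup F] [NormedSpace ℝ F] :
    Continuous fun q : E × F => (innerSL ℝ q.1).smulRight q.2 :=
  (ContinuousLinearMap.smulRightL ℝ E F).continuous₂.comp
    (((innerSL ℝ).continuous.comp continuous_fst).prodMk continuous_snd)

theorem hasFDerivAt_exp_inner_smul {E F : Type*} [NormedAddCommGroup E] [InnerProductSpace ℝ E]
    [NormedAddCommGroup F] [NormedSpace ℝ F] (x : E) (y : F) (η : E) :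
    HasFDerivAt (fun η : E => Real.exp ⟪η, x⟫ • y)
      (Real.exp ⟪η, x⟫ • (innerSL ℝ x).smulRight y) η := by
  have h1 : HasFDerivAt (fun η : E => ⟪η, x⟫) (innerSL ℝ x) η := by
    refine (innerSL ℝ x).hasFDerivAt.congr_of_eventuallyEq
      (Filter.Eventually.of_forall fun z => ?_)
    simp [real_inner_comm]
  have h2 := h1.exp.smul_const y
  convert h2 using 1
  ext v
  simp [smul_smul]

variable {F : Type} [NormedAddCommGroup F] [NormedSpace ℝ F]

theorem aestronglyMeasurable_innerSL_smulRight {E F : Type*} [NormedAddCommGroup E]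
    [InnerProductSpace ℝ E] [NormedAddCommGroup F] [NormedSpace ℝ F] [MeasurableSpace E]
    [OpensMeasurableSpace E] [SecondCountableTopology E] {μ : Measure E} {G : E → F}
    (hG : AEStronglyMeasurable G μ) :
    AEStronglyMeasurable (fun x => (innerSL ℝ x).smulRight (G x)) μ := by
  have h : AEStronglyMeasurable (fun x : E => (x, G x)) μ :=
    AEStronglyMeasurable.prodMk continuous_id.aestronglyMeasurable hG
  exact continuous_innerSL_smulRight.comp_aestronglyMeasurable h

/-- Differentiation under the integral sign. The weight `G` is vector valued and of polynomial
growth so that the derivative is an integral of the same kind, with the growth exponent raised by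
one. -/
theorem hasFDerivAt_integral_exp_inner_smul_of_integrable {E F : Type*} [NormedAddCommGroup E]
    [InnerProductSpace ℝ E] [NormedAddCommGroup F] [NormedSpace ℝ F] [MeasurableSpace E]
    [OpensMeasurableSpace E] [SecondCountableTopology E] {μ : Measure E} {G : E → F}
    (hG : AEStronglyMeasurable G μ) {C : ℝ} {m : ℕ} (hC : ∀ x, ‖G x‖ ≤ C * ‖x‖ ^ m)
    {θ : E} {δ : ℝ} (hδ : 0 < δ) (hint : Integrable (fun x => Real.exp (⟪θ, x⟫ + δ * ‖x‖)) μ) :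
    Integrable (fun x => Real.exp ⟪θ, x⟫ • G x) μ ∧
    HasFDerivAt (fun η => ∫ x, Real.exp ⟪η, x⟫ • G x ∂μ)
      (∫ x, Real.exp ⟪θ, x⟫ • (innerSL ℝ x).smulRight (G x) ∂μ) θ := by
  have hm : ∀ η : E, AEStronglyMeasurable (fun x => Real.exp ⟪η, x⟫) μ := fun η =>
    (by fun_prop : Continuous fun x : E => Real.exp ⟪η, x⟫).aestronglyMeasurable
  -- Half of `δ` pays for moving `η` away from `θ`, the other half absorbs the power of ‖x‖.
  have key : ∀ k, ∀ K : ℝ, 0 ≤ K → ∃ B : ℝ, ∀ x : E,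
      ∀ η ∈ Metric.ball θ (δ / 2),
      Real.exp ⟪η, x⟫ * (K * ‖x‖ ^ k) ≤ B * Real.exp (⟪θ, x⟫ + δ * ‖x‖) := by
    intro k K hK
    refine ⟨K * (k.factorial / (δ / 2) ^ k), fun x η hη => ?_⟩
    have h1 : ⟪η, x⟫ ≤ ⟪θ, x⟫ + δ / 2 * ‖x‖ := by
      have : ⟪η, x⟫ = ⟪θ, x⟫ + ⟪η - θ, x⟫ := by rw [inner_sub_left]; ring
      rw [this]
      gcongr
      refine (real_inner_le_norm _ _).trans ?_
      gcongr
      simpa [dist_eq_norm] using (Metric.mem_ball.1 hη).le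
    calc Real.exp ⟪η, x⟫ * (K * ‖x‖ ^ k)
        ≤ Real.exp (⟪θ, x⟫ + δ / 2 * ‖x‖) *
          (K * (k.factorial / (δ / 2) ^ k * Real.exp (δ / 2 * ‖x‖))) := by
          gcongr
          exact pow_le_mul_exp (by positivity) k (norm_nonneg x)
      _ = K * (k.factorial / (δ / 2) ^ k) *
          (Real.exp (⟪θ, x⟫ + δ / 2 * ‖x‖) * Real.exp (δ / 2 * ‖x‖)) := by ring
      _ = _ := by rw [← Real.exp_add]; ring_nf
  have hC' : ∀ x, ‖G x‖ ≤ |C| * ‖x‖ ^ m := fun x =>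
    (hC x).trans (by gcongr; exact le_abs_self C)
  obtain ⟨B₀, hB₀⟩ := key m |C| (abs_nonneg C)
  obtain ⟨B₁, hB₁⟩ := key (m + 1) |C| (abs_nonneg C)
  have hθ : θ ∈ Metric.ball θ (δ / 2) := Metric.mem_ball_self (by positivity)
  have hI : Integrable (fun x => Real.exp ⟪θ, x⟫ • G x) μ := by
    refine Integrable.mono' (hint.const_mul B₀)
      ((hm θ).smul hG) (Filter.Eventually.of_forall fun x => ?_)
    rw [norm_smul, Real.norm_of_nonneg (Real.exp_pos _).le]
    exact (mul_le_mul_of_nonneg_left (hC' x) (Real.exp_pos _).le).trans (hB₀ x θ hθ)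
  refine ⟨hI, ?_⟩
  have hmeas := aestronglyMeasurable_innerSL_smulRight hG
  refine hasFDerivAt_integral_of_dominated_of_fderiv_le (F := fun η x => Real.exp ⟪η, x⟫ • G x)
    (F' := fun η x => Real.exp ⟪η, x⟫ • (innerSL ℝ x).smulRight (G x))
    (s := Metric.ball θ (δ / 2)) (bound := fun x => B₁ * Real.exp (⟪θ, x⟫ + δ * ‖x‖))
    (Metric.ball_mem_nhds _ (by positivity))
    (Filter.Eventually.of_forall fun η => (hm η).smul hG) hI
    ((hm θ).smul hmeas)
    (Filter.Eventually.of_forall fun x η hη => ?_) (hint.const_mul B₁)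
    (Filter.Eventually.of_forall fun x η _ => ?_)
  · rw [norm_smul, Real.norm_of_nonneg (Real.exp_pos _).le,
      ContinuousLinearMap.norm_smulRight_apply, innerSL_apply_norm]
    refine le_trans (mul_le_mul_of_nonneg_left ?_ (Real.exp_pos _).le) (hB₁ x η hη)
    calc ‖x‖ * ‖G x‖ ≤ ‖x‖ * (|C| * ‖x‖ ^ m) := by gcongr; exact hC' x
      _ = _ := by ring
  · exact hasFDerivAt_exp_inner_smul x (G x) η

theorem hasFDerivAt_integral_exp_inner_smul {G : EuclideanSpace ℝ (Fin n) → F}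
    (hG : AEStronglyMeasurable G μ) {C : ℝ} {m : ℕ} (hC : ∀ x, ‖G x‖ ≤ C * ‖x‖ ^ m)
    {θ : EuclideanSpace ℝ (Fin n)} (h : θ ∈ laplaceDomain μ) :
    Integrable (fun x => Real.exp ⟪θ, x⟫ • G x) μ ∧
    HasFDerivAt (fun η => ∫ x, Real.exp ⟪η, x⟫ • G x ∂μ)
      (∫ x, Real.exp ⟪θ, x⟫ • (innerSL ℝ x).smulRight (G x) ∂μ) θ := by
  obtain ⟨δ, hδ, hint⟩ := exists_integrable_exp_inner_add_norm h
  exact hasFDerivAt_integral_exp_inner_smul_of_integrable hG hC hδ hint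

/-- `F` is quantified inside the induction because each derivative replaces it by a space of linear
maps into it. -/
theorem contDiffOn_integral_exp_inner_smul (k : ℕ) :
    ∀ {F : Type} [NormedAddCommGroup F] [NormedSpace ℝ F] {G : EuclideanSpace ℝ (Fin n) → F}
    (_ : AEStronglyMeasurable G μ) {C : ℝ} {m : ℕ} (_ : ∀ x, ‖G x‖ ≤ C * ‖x‖ ^ m),
    ContDiffOn ℝ k (fun η => ∫ x, Real.exp ⟪η, x⟫ • G x ∂μ) (laplaceDomain μ) := by
  induction k with
  | zero =>
    intro F _ _ G hG C m hC
    simp only [Nat.cast_zero, contDiffOn_zero]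
    exact fun θ h =>
      (hasFDerivAt_integral_exp_inner_smul hG hC h).2.continuousAt.continuousWithinAt
  | succ k ih =>
    intro F _ _ G hG C m hC
    push_cast
    rw [contDiffOn_succ_iff_fderiv_of_isOpen isOpen_laplaceDomain]
    refine ⟨fun θ h => (hasFDerivAt_integral_exp_inner_smul hG hC
      h).2.differentiableAt.differentiableWithinAt, by simp, ?_⟩
    have hmeas := aestronglyMeasurable_innerSL_smulRight hG
    refine (ih hmeas (C := C) (m := m + 1) fun x => ?_).congr fun θ h =>
      (hasFDerivAt_integral_exp_inner_smul hG hC h).2.fderiv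
    rw [ContinuousLinearMap.norm_smulRight_apply, innerSL_apply_norm]
    calc ‖x‖ * ‖G x‖ ≤ ‖x‖ * (C * ‖x‖ ^ m) := by gcongr; exact hC x
      _ = _ := by ring

theorem contDiffOn_laplace : ContDiffOn ℝ (⊤ : ℕ∞) (laplace μ) (laplaceDomain μ) := by
  rw [contDiffOn_infty]
  intro k
  have := contDiffOn_integral_exp_inner_smul (μ := μ) k (G := fun _ => (1 : ℝ))
    aestronglyMeasurable_const (C := 1) (m := 0) (by simp)
  have h3 : laplace μ = fun η => ∫ x, Real.exp ⟪η, x⟫ • (1 : ℝ) ∂μ := by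
    ext η; simp [laplace]
  rwa [h3]

theorem fderiv_laplace {θ : EuclideanSpace ℝ (Fin n)} (h : θ ∈ laplaceDomain μ)
    (u : EuclideanSpace ℝ (Fin n)) :
    Integrable (fun x => ⟪u, x⟫ * Real.exp ⟪θ, x⟫) μ ∧
    fderiv ℝ (laplace μ) θ u = ∫ x, ⟪u, x⟫ * Real.exp ⟪θ, x⟫ ∂μ := by
  have h1 := (hasFDerivAt_integral_exp_inner_smul (μ := μ) (G := fun _ => (1 : ℝ))
    aestronglyMeasurable_const (C := 1) (m := 0) (by simp) h).2
  have hmeas := aestronglyMeasurable_innerSL_smulRight (μ := μ) (G := fun _ => (1 : ℝ))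
    aestronglyMeasurable_const
  have h2 := (hasFDerivAt_integral_exp_inner_smul (μ := μ)
    (G := fun x => (innerSL ℝ x).smulRight (1 : ℝ)) hmeas (C := 1) (m := 1) (fun x => by
      rw [ContinuousLinearMap.norm_smulRight_apply, innerSL_apply_norm]; simp) h).1
  have h3 : laplace μ = fun η => ∫ x, Real.exp ⟪η, x⟫ • (1 : ℝ) ∂μ := by
    ext η; simp [laplace]
  constructor
  · have := (ContinuousLinearMap.apply ℝ ℝ u).integrable_comp h2
    refine this.congr (Filter.Eventually.of_forall fun x => ?_)
    simp [real_inner_comm, mul_comm]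
  · rw [h3, h1.fderiv, ContinuousLinearMap.integral_apply h2]
    refine integral_congr_ae (Filter.Eventually.of_forall fun x => ?_)
    simp [real_inner_comm, mul_comm]

theorem laplace_pos [NeZero μ] {θ : EuclideanSpace ℝ (Fin n)}
    (h : Integrable (fun x => Real.exp ⟪θ, x⟫) μ) : 0 < laplace μ θ :=
  integral_exp_pos h

theorem contDiffOn_cumulant [NeZero μ] :
    ContDiffOn ℝ (⊤ : ℕ∞) (cumulant μ) (laplaceDomain μ) :=
  contDiffOn_laplace.log fun _ h => (laplace_pos (integrable_of_mem_laplaceDomain h)).ne'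

theorem fderiv_cumulant [NeZero μ] {θ : EuclideanSpace ℝ (Fin n)} (h : θ ∈ laplaceDomain μ)
    (u : EuclideanSpace ℝ (Fin n)) :
    fderiv ℝ (cumulant μ) θ u = (∫ x, ⟪u, x⟫ * Real.exp ⟪θ, x⟫ ∂μ) / laplace μ θ := by
  have hd : DifferentiableAt ℝ (laplace μ) θ :=
    (contDiffOn_laplace.differentiableOn (by simp)).differentiableAt
      (isOpen_laplaceDomain.mem_nhds h)
  have := hd.hasFDerivAt.log (laplace_pos (integrable_of_mem_laplaceDomain h)).ne'
  change fderiv ℝ (fun η => Real.log (laplace μ η)) θ u = _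
  rw [this.fderiv, ← (fderiv_laplace h u).2]
  simp [div_eq_inv_mul]

/-- Two points with the same mean differ by a direction in which `μ` is degenerate, so the
cumulant functions near them differ by a constant. -/
theorem hessian_cumulant_eq_of_gradient_eq [NeZero μ] {θ θ' : EuclideanSpace ℝ (Fin n)}
    (h : θ ∈ laplaceDomain μ) (h' : θ' ∈ laplaceDomain μ)
    (heq : gradient (cumulant μ) θ = gradient (cumulant μ) θ') :
    hessian (cumulant μ) θ = hessian (cumulant μ) θ' := by
  set u := θ - θ' with hu
  have hfd : fderiv ℝ (cumulant μ) θ = fderiv ℝ (cumulant μ) θ' := by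
    simpa [gradient] using heq
  have hL := laplace_pos (integrable_of_mem_laplaceDomain h)
  have hL' := laplace_pos (integrable_of_mem_laplaceDomain h')
  set c := fderiv ℝ (cumulant μ) θ u with hc
  have e1 : ∫ x, ⟪u, x⟫ * Real.exp ⟪θ, x⟫ ∂μ = c * laplace μ θ := by
    rw [hc, fderiv_cumulant h, div_mul_cancel₀ _ hL.ne']
  have e2 : ∫ x, ⟪u, x⟫ * Real.exp ⟪θ', x⟫ ∂μ = c * laplace μ θ' := by
    rw [hc, hfd, fderiv_cumulant h', div_mul_cancel₀ _ hL'.ne']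
  have i1 := (fderiv_laplace h u).1
  have i2 := (fderiv_laplace h' u).1
  have j1 := integrable_of_mem_laplaceDomain h
  have j2 := integrable_of_mem_laplaceDomain h'
  -- Both factors have the sign of ⟪u, x⟫ - c, so the product is nonnegative. Its integral vanishes
  -- because ⟪u, x⟫ has the same mean `c` under both tilted measures.
  have hI : Integrable (fun x => (⟪u, x⟫ - c) * (Real.exp ⟪θ, x⟫ - Real.exp c * Real.exp ⟪θ', x⟫))
      μ := by
    refine ((i1.sub (j1.const_mul c)).sub ((i2.sub (j2.const_mul c)).const_mul
      (Real.exp c))).congr (Filter.Eventually.of_forall fun x => ?_)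
    simp only [Pi.sub_apply]; ring
  have hzero : ∫ x, (⟪u, x⟫ - c) * (Real.exp ⟪θ, x⟫ - Real.exp c * Real.exp ⟪θ', x⟫) ∂μ = 0 := by
    have : (fun x => (⟪u, x⟫ - c) * (Real.exp ⟪θ, x⟫ - Real.exp c * Real.exp ⟪θ', x⟫)) =
        fun x => (⟪u, x⟫ * Real.exp ⟪θ, x⟫ - c * Real.exp ⟪θ, x⟫) -
          Real.exp c * (⟪u, x⟫ * Real.exp ⟪θ', x⟫ - c * Real.exp ⟪θ', x⟫) := by
      ext x; ring
    have k1 := i1.sub (j1.const_mul c)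
    have k2 := (i2.sub (j2.const_mul c)).const_mul (Real.exp c)
    simp only [Pi.sub_def] at k1 k2
    rw [this, integral_sub k1 k2, integral_const_mul, integral_sub i1 (j1.const_mul c),
      integral_sub i2 (j2.const_mul c),
      e1, e2, integral_const_mul, integral_const_mul]
    simp [laplace]
  have hfac : ∀ x : EuclideanSpace ℝ (Fin n),
      Real.exp ⟪θ, x⟫ = Real.exp ⟪u, x⟫ * Real.exp ⟪θ', x⟫ := by
    intro x; rw [← Real.exp_add, ← inner_add_left, hu, sub_add_cancel]
  have hnn : ∀ x : EuclideanSpace ℝ (Fin n),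
      0 ≤ (⟪u, x⟫ - c) * (Real.exp ⟪θ, x⟫ - Real.exp c * Real.exp ⟪θ', x⟫) := by
    intro x
    rw [hfac, ← sub_mul, ← mul_assoc]
    refine mul_nonneg ?_ (Real.exp_pos _).le
    rcases le_total c ⟪u, x⟫ with hx | hx
    · exact mul_nonneg (sub_nonneg.2 hx) (sub_nonneg.2 (Real.exp_le_exp.2 hx))
    · exact mul_nonneg_of_nonpos_of_nonpos (sub_nonpos.2 hx) (sub_nonpos.2 (Real.exp_le_exp.2 hx))
  have hae : ∀ᵐ x ∂μ, ⟪u, x⟫ = c := by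
    have := (integral_eq_zero_iff_of_nonneg hnn hI).1 hzero
    filter_upwards [this] with x hx
    simp only [Pi.zero_apply] at hx
    rw [hfac, ← sub_mul] at hx
    rcases mul_eq_zero.1 hx with h0 | h0
    · linarith
    · rcases mul_eq_zero.1 h0 with h1 | h1
      · exact Real.exp_injective (by linarith)
      · exact absurd h1 (Real.exp_pos _).ne'
  have hlap : ∀ η, laplace μ (η + u) = Real.exp c * laplace μ η := by
    intro η
    simp only [laplace]
    rw [← integral_const_mul]
    refine integral_congr_ae ?_
    filter_upwards [hae] with x hx
    rw [inner_add_left, Real.exp_add, hx, mul_comm]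
  have hcum : ∀ᶠ η in 𝓝 θ', cumulant μ (η + u) = c + cumulant μ η := by
    filter_upwards [isOpen_laplaceDomain.mem_nhds h'] with η hη
    rw [cumulant, hlap, Real.log_mul (Real.exp_pos c).ne'
      (laplace_pos (integrable_of_mem_laplaceDomain hη)).ne', Real.log_exp, cumulant]
  have hfd2 : ∀ᶠ η in 𝓝 θ', fderiv ℝ (cumulant μ) (η + u) = fderiv ℝ (cumulant μ) η := by
    filter_upwards [hcum.eventually_nhds] with η hη
    rw [← fderiv_comp_add_right, Filter.EventuallyEq.fderiv_eq hη, fderiv_const_add]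
  have hθ : θ = θ' + u := by rw [hu]; abel
  ext i j
  simp only [hessian, Matrix.of_apply]
  rw [hθ, ← fderiv_comp_add_right]
  congr 1
  refine Filter.EventuallyEq.fderiv_eq ?_
  filter_upwards [hfd2] with η hη
  rw [hη]

/-- Turns a hypothesis stated through a chosen preimage of the mean into an equation between
derivatives of the cumulant at every point of the domain. -/
theorem varianceFunction_gradient [NeZero μ] {θ : EuclideanSpace ℝ (Fin n)}
    (h : θ ∈ laplaceDomain μ) :
    varianceFunction μ (gradient (cumulant μ) θ) = hessian (cumulant μ) θ := by
  have hex : ∃ η ∈ laplaceDomain μ, gradient (cumulant μ) η = gradient (cumulant μ) θ :=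
    ⟨θ, h, rfl⟩
  exact hessian_cumulant_eq_of_gradient_eq (Function.invFunOn_mem hex) h
    (Function.invFunOn_eq hex)

theorem gradient_apply (g : EuclideanSpace ℝ (Fin n) → ℝ) (θ : EuclideanSpace ℝ (Fin n))
    (i : Fin n) : gradient g θ i = fderiv ℝ g θ (EuclideanSpace.single i 1) := by
  have : fderiv ℝ g θ (EuclideanSpace.single i 1) =
      ⟪gradient g θ, EuclideanSpace.single i 1⟫ := by
    simp [gradient]
  rw [this, EuclideanSpace.inner_single_right]
  simp

end Smoothness

end NEF

namespace NEF

open Set Filter Topology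

/-! ### The linear system of partial differential equations. -/

section PartialDerivatives

/-- The `i`-th partial derivative. -/
noncomputable def pderiv (i : Fin 2) (g : EuclideanSpace ℝ (Fin 2) → ℝ) :
    EuclideanSpace ℝ (Fin 2) → ℝ :=
  fun θ => fderiv ℝ g θ (EuclideanSpace.single i 1)

variable {U : Set (EuclideanSpace ℝ (Fin 2))} {g h : EuclideanSpace ℝ (Fin 2) → ℝ}

theorem contDiffOn_pderiv (hU : IsOpen U) (hg : ContDiffOn ℝ (⊤ : ℕ∞) g U) (i : Fin 2) :
    ContDiffOn ℝ (⊤ : ℕ∞) (pderiv i g) U :=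
  (hg.fderiv_of_isOpen hU (by simp)).clm_apply contDiffOn_const

theorem contDiffOn_pderiv_iterate (hU : IsOpen U) (hg : ContDiffOn ℝ (⊤ : ℕ∞) g U) (i : Fin 2)
    (k : ℕ) : ContDiffOn ℝ (⊤ : ℕ∞) ((pderiv i)^[k] g) U := by
  induction k with
  | zero => exact hg
  | succ k ih => rw [Function.iterate_succ_apply']; exact contDiffOn_pderiv hU ih i

theorem ContDiffOn.differentiableAt_of_isOpen (hU : IsOpen U)
    (hg : ContDiffOn ℝ (⊤ : ℕ∞) g U) {θ : EuclideanSpace ℝ (Fin 2)} (hθ : θ ∈ U) :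
    DifferentiableAt ℝ g θ :=
  (hg.differentiableOn (by simp)).differentiableAt (hU.mem_nhds hθ)

theorem pderiv_congr (hU : IsOpen U) (hgh : EqOn g h U) (i : Fin 2) :
    EqOn (pderiv i g) (pderiv i h) U := fun θ hθ => by
  have : g =ᶠ[𝓝 θ] h := by
    filter_upwards [hU.mem_nhds hθ] with η hη using hgh hη
  simp only [pderiv, this.fderiv_eq]

theorem pderiv_comm (hU : IsOpen U) (hg : ContDiffOn ℝ (⊤ : ℕ∞) g U) (i j : Fin 2) :
    EqOn (pderiv i (pderiv j g)) (pderiv j (pderiv i g)) U := fun θ hθ => by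
  have hc : ContDiffAt ℝ (⊤ : ℕ∞) g θ := hg.contDiffAt (hU.mem_nhds hθ)
  have hs : IsSymmSndFDerivAt ℝ g θ := hc.isSymmSndFDerivAt (by
    rw [minSmoothness_of_isRCLikeNormedField]; exact WithTop.coe_le_coe.2 (le_top : (2 : ℕ∞) ≤ ⊤))
  have hd : DifferentiableAt ℝ (fderiv ℝ g) θ :=
    ((hg.fderiv_of_isOpen hU (m := (⊤ : ℕ∞)) (by simp)).differentiableOn
      (by simp)).differentiableAt (hU.mem_nhds hθ)
  have : ∀ i j, pderiv i (pderiv j g) θ =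
      fderiv ℝ (fderiv ℝ g) θ (EuclideanSpace.single i 1) (EuclideanSpace.single j 1) := by
    intro i j
    have := hd.hasFDerivAt.clm_apply
      (hasFDerivAt_const (EuclideanSpace.single j (1 : ℝ) : EuclideanSpace ℝ (Fin 2)) θ)
    change fderiv ℝ (fun η => fderiv ℝ g η (EuclideanSpace.single j 1)) θ _ = _
    rw [this.fderiv]
    simp
  rw [this, this]
  exact hs _ _

theorem hasFDerivAt_pderiv {θ : EuclideanSpace ℝ (Fin 2)} (hg : DifferentiableAt ℝ g θ) :
    HasFDerivAt g (pderiv 0 g θ • EuclideanSpace.proj 0 + pderiv 1 g θ • EuclideanSpace.proj 1 :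
      EuclideanSpace ℝ (Fin 2) →L[ℝ] ℝ) θ := by
  convert hg.hasFDerivAt using 1
  ext v
  have hv : v = v 0 • EuclideanSpace.single (0 : Fin 2) (1 : ℝ) +
      v 1 • EuclideanSpace.single (1 : Fin 2) (1 : ℝ) := by
    ext i; fin_cases i <;> simp
  conv_rhs => rw [hv]
  simp [pderiv, mul_comm]

theorem pderiv_linear_combination {θ : EuclideanSpace ℝ (Fin 2)}
    {g₁ g₂ g₃ : EuclideanSpace ℝ (Fin 2) → ℝ} (h₁ : DifferentiableAt ℝ g₁ θ)
    (h₂ : DifferentiableAt ℝ g₂ θ) (h₃ : DifferentiableAt ℝ g₃ θ) (x y z : ℝ) (i : Fin 2) :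
    pderiv i (fun η => x * g₁ η + y * g₂ η + z * g₃ η) θ =
      x * pderiv i g₁ θ + y * pderiv i g₂ θ + z * pderiv i g₃ θ := by
  have := ((h₁.hasFDerivAt.const_mul x).add (h₂.hasFDerivAt.const_mul y)).add
    (h₃.hasFDerivAt.const_mul z)
  change fderiv ℝ ((fun η => x * g₁ η) + (fun η => y * g₂ η) + fun η => z * g₃ η) θ _ = _
  rw [this.fderiv]
  simp [pderiv]

theorem pderiv_exp_mul (hU : IsOpen U) (hg : ContDiffOn ℝ (⊤ : ℕ∞) g U) (B : ℝ) (i : Fin 2) :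
    EqOn (pderiv i fun θ => Real.exp (B * g θ))
      (fun θ => B * (pderiv i g θ * Real.exp (B * g θ))) U := fun θ hθ => by
  have := ((ContDiffOn.differentiableAt_of_isOpen hU hg hθ).hasFDerivAt.const_mul B).exp
  simp only [pderiv]
  rw [this.fderiv]
  simp only [smul_apply, smul_eq_mul]
  ring

/-- For `B = -A` the term with `B ^ 2` cancels the quadratic part of the variance; this is what
makes the system linear. -/
theorem pderiv_pderiv_exp_mul (hU : IsOpen U) (hg : ContDiffOn ℝ (⊤ : ℕ∞) g U) (B : ℝ)
    (i : Fin 2) :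
    EqOn (pderiv i (pderiv i fun θ => Real.exp (B * g θ)))
      (fun θ => (B * pderiv i (pderiv i g) θ + B ^ 2 * pderiv i g θ ^ 2) * Real.exp (B * g θ))
      U := fun θ hθ => by
  rw [pderiv_congr hU (pderiv_exp_mul hU hg B i) i hθ]
  have h1 := ((ContDiffOn.differentiableAt_of_isOpen hU hg hθ).hasFDerivAt.const_mul B).exp
  have h2 := (ContDiffOn.differentiableAt_of_isOpen hU (contDiffOn_pderiv hU hg i) hθ).hasFDerivAt
  have h3 := (h2.mul h1).const_mul B
  change fderiv ℝ (fun θ => B * (pderiv i g * fun θ => Real.exp (B * g θ)) θ) θ _ = _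
  rw [h3.fderiv]
  simp only [pderiv, smul_apply, smul_eq_mul, add_apply]
  ring

/-- Under the quadratic form of the diagonal of the variance function the power `L_μ ^ (-A)` solves
a linear system of partial differential equations. -/
theorem pde_of_diag_variance {μ : Measure (EuclideanSpace ℝ (Fin 2))} [NeZero μ]
    {A a b c d e f : ℝ}
    (hdiag : ∀ m ∈ meanDomain μ,
      varianceFunction μ m 0 0 = A * m 0 ^ 2 + a * m 0 + b * m 1 + e ∧
      varianceFunction μ m 1 1 = A * m 1 ^ 2 + c * m 0 + d * m 1 + f)
    {g : EuclideanSpace ℝ (Fin 2) → ℝ} (hg : g = fun θ => Real.exp (-A * cumulant μ θ))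
    {θ : EuclideanSpace ℝ (Fin 2)} (hθ : θ ∈ laplaceDomain μ) :
    pderiv 0 (pderiv 0 g) θ = a * pderiv 0 g θ + b * pderiv 1 g θ - A * e * g θ ∧
    pderiv 1 (pderiv 1 g) θ = c * pderiv 0 g θ + d * pderiv 1 g θ - A * f * g θ := by
  obtain ⟨h0, h1⟩ := hdiag _ ⟨θ, hθ, rfl⟩
  rw [varianceFunction_gradient hθ, gradient_apply, gradient_apply] at h0 h1
  change pderiv 0 (pderiv 0 (cumulant μ)) θ = A * pderiv 0 (cumulant μ) θ ^ 2 +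
    a * pderiv 0 (cumulant μ) θ + b * pderiv 1 (cumulant μ) θ + e at h0
  change pderiv 1 (pderiv 1 (cumulant μ)) θ = A * pderiv 1 (cumulant μ) θ ^ 2 +
    c * pderiv 0 (cumulant μ) θ + d * pderiv 1 (cumulant μ) θ + f at h1
  have hk := contDiffOn_cumulant (μ := μ)
  have hU := isOpen_laplaceDomain (μ := μ)
  subst hg
  rw [pderiv_pderiv_exp_mul hU hk _ 0 hθ, pderiv_pderiv_exp_mul hU hk _ 1 hθ,
    pderiv_exp_mul hU hk _ 0 hθ, pderiv_exp_mul hU hk _ 1 hθ]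
  simp only [h0, h1]
  constructor <;> ring

/-- The system as a family of relations between the iterated partial derivatives in `θ₁`. -/
theorem pderiv_iterate_relations {A a b c d e f : ℝ} (hb : b ≠ 0) (hU : IsOpen U)
    (hg : ContDiffOn ℝ (⊤ : ℕ∞) g U)
    (h0 : ∀ θ ∈ U, pderiv 0 (pderiv 0 g) θ = a * pderiv 0 g θ + b * pderiv 1 g θ - A * e * g θ)
    (h1 : ∀ θ ∈ U, pderiv 1 (pderiv 1 g) θ = c * pderiv 0 g θ + d * pderiv 1 g θ - A * f * g θ)
    (k : ℕ) :
    (∀ θ ∈ U, pderiv 1 ((pderiv 0)^[k] g) θ =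
      1 / b * (pderiv 0)^[k + 2] g θ + -a / b * (pderiv 0)^[k + 1] g θ +
        e * A / b * (pderiv 0)^[k] g θ) ∧
    (∀ θ ∈ U, (pderiv 0)^[k + 4] g θ - 2 * a * (pderiv 0)^[k + 3] g θ +
      (2 * A * e + a ^ 2 - d * b) * (pderiv 0)^[k + 2] g θ -
      (2 * A * a * e - a * d * b + c * b ^ 2) * (pderiv 0)^[k + 1] g θ +
      (A ^ 2 * e ^ 2 - e * d * b * A + f * b ^ 2 * A) * (pderiv 0)^[k] g θ = 0) := by
  have hD : ∀ j, ∀ θ ∈ U, DifferentiableAt ℝ ((pderiv 0)^[j] g) θ := fun j θ hθ =>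
    ContDiffOn.differentiableAt_of_isOpen hU (contDiffOn_pderiv_iterate hU hg 0 j) hθ
  have hs : ∀ j θ, pderiv 0 ((pderiv 0)^[j] g) θ = (pderiv 0)^[j + 1] g θ := fun j θ => by
    rw [Function.iterate_succ_apply']
  have first : ∀ k, ∀ θ ∈ U, pderiv 1 ((pderiv 0)^[k] g) θ =
      1 / b * (pderiv 0)^[k + 2] g θ + -a / b * (pderiv 0)^[k + 1] g θ +
        e * A / b * (pderiv 0)^[k] g θ := by
    intro k
    induction k with
    | zero =>
      intro θ hθ
      have := h0 θ hθ
      simp only [Function.iterate_succ_apply', Function.iterate_zero, id]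
      rw [this]
      field_simp
      ring
    | succ k ih =>
      intro θ hθ
      rw [Function.iterate_succ_apply', pderiv_comm hU (contDiffOn_pderiv_iterate hU hg 0 k) 1 0 hθ,
        pderiv_congr hU ih 0 hθ, pderiv_linear_combination (hD _ θ hθ) (hD _ θ hθ) (hD _ θ hθ)]
      simp only [hs]
  refine ⟨first k, ?_⟩
  induction k with
  | zero =>
    intro θ hθ
    -- Apply ∂₂ to ∂₂g = h(∂₁)g and insert the second equation on the left; after clearing
    -- denominators this is the quartic in ∂₁.
    have e0 : EqOn (pderiv 1 g) (fun θ => 1 / b * (pderiv 0)^[2] g θ +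
        -a / b * (pderiv 0)^[1] g θ + e * A / b * (pderiv 0)^[0] g θ) U := fun θ hθ => first 0 θ hθ
    have e1 := pderiv_congr hU e0 1 hθ
    rw [pderiv_linear_combination (hD _ θ hθ) (hD _ θ hθ) (hD _ θ hθ), h1 θ hθ, e0 hθ,
      first 2 θ hθ, first 1 θ hθ, first 0 θ hθ] at e1
    have e2 : pderiv 0 g θ = (pderiv 0)^[1] g θ := rfl
    have e3 : g θ = (pderiv 0)^[0] g θ := rfl
    rw [e2, e3] at e1
    norm_num at e1 ⊢
    field_simp at e1
    linear_combination -e1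
  | succ k ih =>
    intro θ hθ
    -- The first three of the five terms, bundled so that `pderiv_linear_combination` applies twice.
    let h : EuclideanSpace ℝ (Fin 2) → ℝ := fun θ =>
      1 * (pderiv 0)^[k + 4] g θ + (-(2 * a)) * (pderiv 0)^[k + 3] g θ +
      (2 * A * e + a ^ 2 - d * b) * (pderiv 0)^[k + 2] g θ
    have hh : DifferentiableAt ℝ h θ := (((hD _ θ hθ).const_mul _).add
      ((hD _ θ hθ).const_mul _)).add ((hD _ θ hθ).const_mul _)
    have hz : EqOn (fun θ => 1 * h θ +
        (-(2 * A * a * e - a * d * b + c * b ^ 2)) * (pderiv 0)^[k + 1] g θ +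
        (A ^ 2 * e ^ 2 - e * d * b * A + f * b ^ 2 * A) * (pderiv 0)^[k] g θ) (fun _ => 0) U :=
      fun η hη => by
        have := ih η hη
        simp only [h]
        linarith
    have e1 := pderiv_congr hU hz 0 hθ
    have e2 : pderiv 0 (fun _ => (0 : ℝ)) θ = 0 := by simp [pderiv]
    rw [e2, pderiv_linear_combination hh (hD _ θ hθ) (hD _ θ hθ),
      pderiv_linear_combination (hD _ θ hθ) (hD _ θ hθ) (hD _ θ hθ)] at e1
    simp only [hs] at e1
    ring_nf at e1 ⊢
    linarith

end PartialDerivatives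

end NEF

namespace NEF

open Set Filter Topology Polynomial

/-! ### General solution of the system by generalized eigenfunctions. -/

section Representation

/-- The `i`-th coordinate as a complex valued real linear form. -/
noncomputable def coordForm (i : Fin 2) : EuclideanSpace ℝ (Fin 2) →L[ℝ] ℂ :=
  Complex.ofRealCLM.comp (EuclideanSpace.proj i)

@[simp] theorem coordForm_apply (i : Fin 2) (v : EuclideanSpace ℝ (Fin 2)) :
    coordForm i v = (v i : ℂ) := by simp [coordForm]

/-- The second coordinate of the exponent belonging to the first coordinate `z`. -/
noncomputable def height (a b κ : ℝ) (z : ℂ) : ℂ := (z ^ 2 - a * z + κ) / b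

/-- The derivative of `height`. -/
noncomputable def slope (a b : ℝ) (z : ℂ) : ℂ := (2 * z - a) / b

/-- The factor in front of the exponential for a root of multiplicity at most four:
`u` and `v` are the coordinates of the argument. -/
noncomputable def jordanFactor (p : ℂ) (b : ℝ) (c : ℕ → ℂ) (u v : ℝ) : ℂ :=
  c 0 + c 1 * (u + p * v) + c 2 * ((u + p * v) ^ 2 / 2 + v / b) +
    c 3 * ((u + p * v) ^ 3 / 6 + (u + p * v) * (v / b))

variable {U : Set (EuclideanSpace ℝ (Fin 2))}

theorem exists_eq_of_hasFDerivAt_zero (hU : IsOpen U) (hconv : Convex ℝ U)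
    {h : EuclideanSpace ℝ (Fin 2) → ℂ}
    (hh : ∀ θ ∈ U, HasFDerivAt h (0 : EuclideanSpace ℝ (Fin 2) →L[ℝ] ℂ) θ) :
    ∃ c, ∀ θ ∈ U, h θ = c := by
  obtain ⟨c, hc⟩ := hU.exists_is_const_of_fderiv_eq_zero hconv.isPreconnected
    (fun θ hθ => (hh θ hθ).differentiableAt.differentiableWithinAt)
    (fun θ hθ => (hh θ hθ).fderiv)
  exact ⟨c, hc⟩

/-- Solutions of the triangular system satisfied by a chain of generalized eigenfunctions. -/
theorem exists_jordanFactor (hU : IsOpen U) (hconv : Convex ℝ U) {b : ℝ} {p : ℂ}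
    {h : ℕ → EuclideanSpace ℝ (Fin 2) → ℂ}
    (hd : ∀ j, ∀ θ ∈ U, HasFDerivAt (h j)
      (h (j + 1) θ • coordForm 0 + (p * h (j + 1) θ + (1 / b : ℂ) * h (j + 2) θ) • coordForm 1) θ)
    (h4 : ∀ θ ∈ U, h 4 θ = 0) (h5 : ∀ θ ∈ U, h 5 θ = 0) :
    ∃ c : ℕ → ℂ, ∀ θ ∈ U, h 0 θ = jordanFactor p b c (θ 0) (θ 1) := by
  have hl : ∀ θ : EuclideanSpace ℝ (Fin 2),
      HasFDerivAt (fun η : EuclideanSpace ℝ (Fin 2) => coordForm 0 η + p * coordForm 1 η)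
        (coordForm 0 + p • coordForm 1) θ := fun θ =>
    (coordForm 0).hasFDerivAt.add ((coordForm 1).hasFDerivAt.const_mul p)
  have ht : ∀ θ : EuclideanSpace ℝ (Fin 2),
      HasFDerivAt (fun η : EuclideanSpace ℝ (Fin 2) => (1 / b : ℂ) * coordForm 1 η)
        ((1 / b : ℂ) • coordForm 1) θ := fun θ => (coordForm 1).hasFDerivAt.const_mul _
  set l : EuclideanSpace ℝ (Fin 2) → ℂ := fun η => coordForm 0 η + p * coordForm 1 η with hldef
  set t : EuclideanSpace ℝ (Fin 2) → ℂ := fun η => (1 / b : ℂ) * coordForm 1 η with htdef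
  -- The coefficients of exp(-(wl + w²t)) up to w³ combine the `h j` into functions with zero
  -- derivative. The inverse series exp(wl + w²t) supplies the factors in `jordanFactor`.
  obtain ⟨c3, hc3⟩ : ∃ c, ∀ θ ∈ U, h 3 θ = c := by
    refine exists_eq_of_hasFDerivAt_zero hU hconv fun θ hθ => ?_
    refine (hd 3 θ hθ).congr_fderiv ?_
    ext v
    simp [h4 θ hθ, h5 θ hθ]
  obtain ⟨c2, hc2⟩ : ∃ c, ∀ θ ∈ U, (h 2 - l * h 3) θ = c := by
    refine exists_eq_of_hasFDerivAt_zero hU hconv fun θ hθ => ?_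
    refine ((hd 2 θ hθ).sub ((hl θ).mul (hd 3 θ hθ))).congr_fderiv ?_
    ext v
    simp [h4 θ hθ, h5 θ hθ]
    ring
  obtain ⟨c1, hc1⟩ : ∃ c, ∀ θ ∈ U, (h 1 - l * h 2 + (((1 / 2 : ℂ) • (l * l)) - t) * h 3) θ = c := by
    refine exists_eq_of_hasFDerivAt_zero hU hconv fun θ hθ => ?_
    refine (((hd 1 θ hθ).sub ((hl θ).mul (hd 2 θ hθ))).add
      (((((hl θ).mul (hl θ)).const_smul (1 / 2 : ℂ)).sub (ht θ)).mul
        (hd 3 θ hθ))).congr_fderiv ?_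
    ext v
    simp [h4 θ hθ, h5 θ hθ]
    ring
  obtain ⟨c0, hc0⟩ : ∃ c, ∀ θ ∈ U, (h 0 - l * h 1 + (((1 / 2 : ℂ) • (l * l)) - t) * h 2 -
      ((1 / 6 : ℂ) • (l * (l * l)) - l * t) * h 3) θ = c := by
    refine exists_eq_of_hasFDerivAt_zero hU hconv fun θ hθ => ?_
    refine ((((hd 0 θ hθ).sub ((hl θ).mul (hd 1 θ hθ))).add
      (((((hl θ).mul (hl θ)).const_smul (1 / 2 : ℂ)).sub (ht θ)).mul (hd 2 θ hθ))).sub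
      (((((hl θ).mul ((hl θ).mul (hl θ))).const_smul (1 / 6 : ℂ)).sub
        ((hl θ).mul (ht θ))).mul (hd 3 θ hθ))).congr_fderiv ?_
    ext v
    simp [h4 θ hθ, h5 θ hθ]
    ring
  refine ⟨fun j => if j = 0 then c0 else if j = 1 then c1 else if j = 3 then c3 else c2,
    fun θ hθ => ?_⟩
  have e0 := hc0 θ hθ
  have e1 := hc1 θ hθ
  have e2 := hc2 θ hθ
  have e3 := hc3 θ hθ
  simp only [Pi.sub_apply, Pi.add_apply, Pi.mul_apply, Pi.smul_apply, smul_eq_mul] at e0 e1 e2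
  have el : l θ = θ 0 + p * θ 1 := by simp [hldef]
  have et : t θ = θ 1 / b := by simp [htdef]; ring
  rw [jordanFactor, ← el, ← et]
  norm_num
  linear_combination e0 + l θ * e1 + (l θ ^ 2 / 2 + t θ) * e2 +
    (l θ ^ 3 / 6 + l θ * t θ) * e3

/-- Application of a polynomial in the shift to a sequence of functions. -/
noncomputable def shiftApply (F : ℕ → EuclideanSpace ℝ (Fin 2) → ℝ)
    (θ : EuclideanSpace ℝ (Fin 2)) : ℂ[X] →ₗ[ℂ] ℂ :=
  Polynomial.lsum fun k => LinearMap.toSpanSingleton ℂ ℂ (F k θ : ℂ)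

theorem shiftApply_monomial (F : ℕ → EuclideanSpace ℝ (Fin 2) → ℝ)
    (θ : EuclideanSpace ℝ (Fin 2)) (k : ℕ) (c : ℂ) :
    shiftApply F θ (monomial k c) = c * F k θ := by
  simp [shiftApply, Polynomial.lsum_apply, Polynomial.sum_monomial_index]

/-- The polynomial version of `height`. -/
noncomputable def heightPoly (a b κ : ℝ) : ℂ[X] :=
  C (1 / b : ℂ) * X ^ 2 + C (-a / b : ℂ) * X + C (κ / b : ℂ)

/-- Multiplication by `X` acts as ∂₁ and multiplication by `heightPoly` as ∂₂, so the calculus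
becomes algebra in ℂ[X]. -/
theorem hasFDerivAt_shiftApply {a b κ : ℝ} {F : ℕ → EuclideanSpace ℝ (Fin 2) → ℝ}
    {θ : EuclideanSpace ℝ (Fin 2)}
    (hF : ∀ k, HasFDerivAt (F k) (F (k + 1) θ • EuclideanSpace.proj 0 +
      (1 / b * F (k + 2) θ + -a / b * F (k + 1) θ + κ / b * F k θ) • EuclideanSpace.proj 1 :
      EuclideanSpace ℝ (Fin 2) →L[ℝ] ℝ) θ) (r : ℂ[X]) :
    HasFDerivAt (fun η => shiftApply F η r) (shiftApply F θ (X * r) • coordForm 0 +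
      shiftApply F θ (heightPoly a b κ * r) • coordForm 1) θ := by
  induction r using Polynomial.induction_on' with
  | add r s hr hs =>
    refine ((hr.add hs).congr_fderiv ?_).congr_of_eventuallyEq
      (Filter.Eventually.of_forall fun η => map_add _ _ _)
    ext v
    simp [mul_add]
    ring
  | monomial k c =>
    have h1 := (Complex.ofRealCLM.hasFDerivAt.comp θ (hF k)).const_mul c
    simp only [shiftApply_monomial]
    refine h1.congr_fderiv ?_
    have e1 : (X : ℂ[X]) * monomial k c = monomial (k + 1) c := X_mul_monomial k c
    have e2 : heightPoly a b κ * monomial k c = monomial (k + 2) (1 / b * c) +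
        monomial (k + 1) (-a / b * c) + monomial k (κ / b * c) := by
      rw [heightPoly, add_mul, add_mul, mul_assoc, mul_assoc, X_mul_monomial, X_pow_mul_monomial,
        C_mul_monomial, C_mul_monomial, C_mul_monomial]
    rw [e1, e2]
    simp only [map_add, shiftApply_monomial]
    ext v
    simp
    ring

theorem shiftApply_mul_eq_zero {q : ℂ[X]} {F : ℕ → EuclideanSpace ℝ (Fin 2) → ℝ}
    {θ : EuclideanSpace ℝ (Fin 2)} (hq : ∀ k, shiftApply F θ (q * X ^ k) = 0) (r : ℂ[X]) :
    shiftApply F θ (q * r) = 0 := by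
  induction r using Polynomial.induction_on' with
  | add r s hr hs => rw [mul_add, map_add, hr, hs, add_zero]
  | monomial k c =>
    rw [← C_mul_X_pow_eq_monomial, mul_left_comm, ← smul_eq_C_mul, map_smul, hq, smul_zero]

/-- A partition of unity subordinate to the roots. -/
theorem exists_sum_eq_one_of_roots {q : ℂ[X]} (hq : q.Monic) (hdeg : q.natDegree = 4) :
    ∃ ε : ℂ → ℂ[X], ∑ z ∈ q.roots.toFinset, ε z = 1 ∧
      ∀ z ∈ q.roots.toFinset, ∃ s, ε z * (X - C z) ^ 4 = q * s := by
  classical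
  have hprod : ∏ z ∈ q.roots.toFinset, (X - C z) ^ q.rootMultiplicity z = q := by
    rw [← prod_multiset_root_eq_finset_root]
    have := (IsAlgClosed.splits q).eq_prod_roots
    rw [hq.leadingCoeff, C_1, one_mul] at this
    exact this.symm
  have hne : q.roots.toFinset.Nonempty := by
    obtain ⟨z, hz⟩ := IsAlgClosed.exists_root q (by
      rw [degree_eq_natDegree hq.ne_zero, hdeg]; norm_num)
    exact ⟨z, by simpa [hq.ne_zero] using hz⟩
  -- Bézout coefficients for the cofactors of the powers (X - z)^mult in q; each ε z is such a
  -- coefficient times its cofactor.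
  obtain ⟨m, hm⟩ := (exists_sum_eq_one_iff_pairwise_coprime
    (s := fun z : ℂ => (X - C z) ^ q.rootMultiplicity z) hne).2 (fun i j hij =>
      (isCoprime_X_sub_C_of_isUnit_sub
        (sub_ne_zero.2 fun h => hij (Subtype.ext h)).isUnit).pow)
  refine ⟨_, hm, fun z hz => ⟨m z * (X - C z) ^ (4 - q.rootMultiplicity z), ?_⟩⟩
  have hle : q.rootMultiplicity z ≤ 4 := by
    rw [← hdeg, ← count_roots]
    exact (Multiset.count_le_card _ _).trans (card_roots' q)
  have h4 : (X - C z) ^ 4 = (X - C z) ^ q.rootMultiplicity z *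
      (X - C z) ^ (4 - q.rootMultiplicity z) := by
    rw [← pow_add, Nat.add_sub_cancel' hle]
  have hsplit : (∏ j ∈ q.roots.toFinset \ {z}, (X - C j) ^ q.rootMultiplicity j) *
      (X - C z) ^ q.rootMultiplicity z = q := by
    conv_rhs => rw [← hprod, ← Finset.prod_sdiff (Finset.singleton_subset_iff.2 hz)]
    simp
  rw [h4]
  calc _ = m z * ((∏ j ∈ q.roots.toFinset \ {z}, (X - C j) ^ q.rootMultiplicity j) *
      (X - C z) ^ q.rootMultiplicity z) * (X - C z) ^ (4 - q.rootMultiplicity z) := by ring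
    _ = _ := by rw [hsplit]; ring

/-- The general solution of the shift system. -/
theorem exists_representation {a b κ : ℝ} {F : ℕ → EuclideanSpace ℝ (Fin 2) → ℝ}
    (hU : IsOpen U) (hconv : Convex ℝ U)
    (hF : ∀ k, ∀ θ ∈ U, HasFDerivAt (F k) (F (k + 1) θ • EuclideanSpace.proj 0 +
      (1 / b * F (k + 2) θ + -a / b * F (k + 1) θ + κ / b * F k θ) • EuclideanSpace.proj 1 :
      EuclideanSpace ℝ (Fin 2) →L[ℝ] ℝ) θ)
    {q : ℂ[X]} (hq : q.Monic) (hdeg : q.natDegree = 4)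
    (hqF : ∀ k, ∀ θ ∈ U, shiftApply F θ (q * X ^ k) = 0) :
    ∃ c : ℂ → ℕ → ℂ, ∀ θ ∈ U, (F 0 θ : ℂ) = ∑ z ∈ q.roots.toFinset,
      Complex.exp (z * θ 0 + height a b κ z * θ 1) *
        jordanFactor (slope a b z) b (c z) (θ 0) (θ 1) := by
  obtain ⟨ε, hε, hεq⟩ := exists_sum_eq_one_of_roots hq hdeg
  have key : ∀ z ∈ q.roots.toFinset, ∃ c : ℕ → ℂ, ∀ θ ∈ U, shiftApply F θ (ε z) =
      Complex.exp (z * θ 0 + height a b κ z * θ 1) *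
        jordanFactor (slope a b z) b c (θ 0) (θ 1) := by
    intro z hz
    obtain ⟨s, hs⟩ := hεq z hz
    -- Multiplying by the inverse exponential removes the eigenvalue and leaves a nilpotent chain.
    let w : EuclideanSpace ℝ (Fin 2) → ℂ := fun θ =>
      Complex.exp (-(z * coordForm 0 θ + height a b κ z * coordForm 1 θ))
    have hw : ∀ θ, HasFDerivAt w
        (w θ • -(z • coordForm 0 + height a b κ z • coordForm 1)) θ := fun θ =>
      (((coordForm 0).hasFDerivAt.const_mul z).add
        ((coordForm 1).hasFDerivAt.const_mul (height a b κ z))).neg.cexp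
    obtain ⟨c, hc⟩ := exists_jordanFactor (b := b) (p := slope a b z)
      (h := fun j => w * fun θ => shiftApply F θ (ε z * (X - C z) ^ j)) hU hconv
      (fun j θ hθ => by
        refine ((hw θ).mul (hasFDerivAt_shiftApply (fun k => hF k θ hθ)
          (ε z * (X - C z) ^ j))).congr_fderiv ?_
        have e1 : X * (ε z * (X - C z) ^ j) =
            ε z * (X - C z) ^ (j + 1) + z • (ε z * (X - C z) ^ j) := by
          rw [smul_eq_C_mul]; ring
        have e2 : heightPoly a b κ * (ε z * (X - C z) ^ j) =
            slope a b z • (ε z * (X - C z) ^ (j + 1)) +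
            (1 / b : ℂ) • (ε z * (X - C z) ^ (j + 2)) +
            height a b κ z • (ε z * (X - C z) ^ j) := by
          -- Taylor expansion of the height polynomial at `z`.
          have e3 : heightPoly a b κ = C (slope a b z) * (X - C z) +
              C (1 / b : ℂ) * (X - C z) ^ 2 + C (height a b κ z) := by
            have e4 : C (slope a b z) = C (2 * z * (1 / b : ℂ) + -a / b) := by
              congr 1; rw [slope]; ring
            have e5 : C (height a b κ z) =
                C (z ^ 2 * (1 / b : ℂ) + -a / b * z + κ / b) := by
              congr 1; rw [height]; ring
            rw [heightPoly, e4, e5]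
            simp only [map_add, map_mul, map_pow, map_ofNat]
            ring
          rw [e3]
          simp only [smul_eq_C_mul]
          ring
        rw [e1, e2]
        ext v
        simp
        ring)
      (fun θ hθ => by
        simp only [Pi.mul_apply]
        rw [hs, shiftApply_mul_eq_zero (fun k => hqF k θ hθ), mul_zero])
      (fun θ hθ => by
        simp only [Pi.mul_apply]
        rw [pow_succ, ← mul_assoc, hs, mul_assoc,
          shiftApply_mul_eq_zero (fun k => hqF k θ hθ), mul_zero])
    refine ⟨c, fun θ hθ => ?_⟩
    have h0 := hc θ hθ
    simp only [Pi.mul_apply, pow_zero, mul_one] at h0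
    rw [← h0, ← mul_assoc]
    simp only [w, coordForm_apply]
    rw [← Complex.exp_add, add_neg_cancel, Complex.exp_zero, one_mul]
  choose! c hc using key
  refine ⟨c, fun θ hθ => ?_⟩
  have h1 : (F 0 θ : ℂ) = shiftApply F θ 1 := by
    rw [← monomial_zero_one, shiftApply_monomial, one_mul]
  rw [h1, ← hε, map_sum]
  exact Finset.sum_congr rfl fun z hz => hc z hz θ hθ

end Representation

end NEF

namespace NEF

open Set Filter Topology Polynomial

/-! ### The representation of the power of the Laplace transform. -/

section LaplaceRepresentation

/-- The quartic over the complex numbers. -/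
noncomputable def complexQuartic (A a b c d e f : ℝ) : ℂ[X] :=
  (quartic A a b c d e f).map (algebraMap ℝ ℂ)

theorem natDegree_quartic (A a b c d e f : ℝ) : (quartic A a b c d e f).natDegree = 4 := by
  unfold quartic
  compute_degree!

theorem monic_quartic (A a b c d e f : ℝ) : (quartic A a b c d e f).Monic := by
  unfold quartic
  monicity!

theorem monic_complexQuartic (A a b c d e f : ℝ) : (complexQuartic A a b c d e f).Monic :=
  (monic_quartic A a b c d e f).map _

theorem natDegree_complexQuartic (A a b c d e f : ℝ) :
    (complexQuartic A a b c d e f).natDegree = 4 := by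
  rw [complexQuartic, natDegree_map, natDegree_quartic]

theorem mem_roots_complexQuartic {A a b c d e f : ℝ} {z : ℂ} :
    z ∈ (complexQuartic A a b c d e f).roots.toFinset ↔ aeval z (quartic A a b c d e f) = 0 := by
  rw [Multiset.mem_toFinset, mem_roots (monic_complexQuartic A a b c d e f).ne_zero, IsRoot.def,
    complexQuartic, eval_map_algebraMap]

theorem conj_mem_roots_complexQuartic {A a b c d e f : ℝ} {z : ℂ}
    (hz : z ∈ (complexQuartic A a b c d e f).roots.toFinset) :
    (starRingEnd ℂ) z ∈ (complexQuartic A a b c d e f).roots.toFinset := by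
  rw [mem_roots_complexQuartic] at hz ⊢
  rw [aeval_conj, hz, map_zero]

theorem ofReal_mem_roots_complexQuartic {A a b c d e f : ℝ} {l : ℝ} :
    (l : ℂ) ∈ (complexQuartic A a b c d e f).roots.toFinset ↔ l ∈ realRoots A a b c d e f := by
  rw [mem_roots_complexQuartic, realRoots, Multiset.mem_toFinset,
    mem_roots (monic_quartic A a b c d e f).ne_zero, IsRoot.def]
  have : aeval (l : ℂ) (quartic A a b c d e f) = ((eval l (quartic A a b c d e f) : ℝ) : ℂ) := by
    have := aeval_algebraMap_apply ℂ l (quartic A a b c d e f)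
    simpa using this
  rw [this, Complex.ofReal_eq_zero]

theorem exists_laplace_representation {μ : Measure (EuclideanSpace ℝ (Fin 2))} [NeZero μ]
    {A a b c d e f : ℝ} (hb : b ≠ 0)
    (hdiag : ∀ m ∈ meanDomain μ,
      varianceFunction μ m 0 0 = A * m 0 ^ 2 + a * m 0 + b * m 1 + e ∧
      varianceFunction μ m 1 1 = A * m 1 ^ 2 + c * m 0 + d * m 1 + f) :
    ∃ γ : ℂ → ℕ → ℂ, ∀ θ ∈ laplaceDomain μ, (Real.exp (-A * cumulant μ θ) : ℂ) =
      ∑ z ∈ (complexQuartic A a b c d e f).roots.toFinset,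
      Complex.exp (z * θ 0 + height a b (e * A) z * θ 1) *
        jordanFactor (slope a b z) b (γ z) (θ 0) (θ 1) := by
  set g : EuclideanSpace ℝ (Fin 2) → ℝ := fun θ => Real.exp (-A * cumulant μ θ) with hg
  have hU := isOpen_laplaceDomain (μ := μ)
  have hgs : ContDiffOn ℝ (⊤ : ℕ∞) g (laplaceDomain μ) :=
    (contDiffOn_const.mul contDiffOn_cumulant).exp
  have hrel := pderiv_iterate_relations hb hU hgs
    (fun θ hθ => (pde_of_diag_variance hdiag hg hθ).1)
    (fun θ hθ => (pde_of_diag_variance hdiag hg hθ).2)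
  have hF : ∀ k, ∀ θ ∈ laplaceDomain μ, HasFDerivAt ((pderiv 0)^[k] g)
      ((pderiv 0)^[k + 1] g θ • EuclideanSpace.proj 0 +
      (1 / b * (pderiv 0)^[k + 2] g θ + -a / b * (pderiv 0)^[k + 1] g θ +
        e * A / b * (pderiv 0)^[k] g θ) • EuclideanSpace.proj 1 :
      EuclideanSpace ℝ (Fin 2) →L[ℝ] ℝ) θ := by
    intro k θ hθ
    rw [← (hrel k).1 θ hθ, Function.iterate_succ_apply']
    exact hasFDerivAt_pderiv (ContDiffOn.differentiableAt_of_isOpen hU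
      (contDiffOn_pderiv_iterate hU hgs 0 k) hθ)
  obtain ⟨γ, hγ⟩ := exists_representation (F := fun k => (pderiv 0)^[k] g) hU convex_laplaceDomain
    hF (monic_complexQuartic A a b c d e f) (natDegree_complexQuartic A a b c d e f)
    (fun k θ hθ => by
      have h1 : complexQuartic A a b c d e f * X ^ k =
          monomial (k + 4) 1 - monomial (k + 3) (2 * a : ℂ) +
          monomial (k + 2) (2 * A * e + a ^ 2 - d * b : ℂ) -
          monomial (k + 1) (2 * A * a * e - a * d * b + c * b ^ 2 : ℂ) +
          monomial k (A ^ 2 * e ^ 2 - e * d * b * A + f * b ^ 2 * A : ℂ) := by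
        simp only [complexQuartic, quartic, ← C_mul_X_pow_eq_monomial, Polynomial.map_add,
          Polynomial.map_sub, Polynomial.map_mul, Polynomial.map_pow, map_X, map_C]
        simp only [Complex.coe_algebraMap, Complex.ofReal_add, Complex.ofReal_sub,
          Complex.ofReal_mul, Complex.ofReal_pow, Complex.ofReal_ofNat]
        simp only [map_one]
        ring
      rw [h1]
      simp only [map_add, map_sub, shiftApply_monomial]
      have := (hrel k).2 θ hθ
      have h2 := congrArg (fun x : ℝ => (x : ℂ)) this
      push_cast at h2
      linear_combination h2)
  exact ⟨γ, fun θ hθ => hγ θ hθ⟩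

end LaplaceRepresentation

end NEF

namespace NEF

open Set Filter Topology

/-! ### Consequences of positivity for the coefficients. -/

section Positivity

/-- A summand of the solution along the line `s ↦ (t + s (2u - a), -b s)`, without the common
exponential factor. -/
noncomputable def lineTerm (γ : ℕ → ℂ) (u t s : ℝ) (z : ℂ) : ℂ :=
  Complex.exp (z * t - s * (z - u) ^ 2) *
    (γ 0 + γ 1 * (t + 2 * s * (u - z)) + γ 2 * ((t + 2 * s * (u - z)) ^ 2 / 2 - s) +
      γ 3 * ((t + 2 * s * (u - z)) ^ 3 / 6 - (t + 2 * s * (u - z)) * s))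

/-- Completing the square in the exponent. The remaining growth rate as s → ∞ is (Im z)² - (Re z -
u)², so the choice of `u` decides which root dominates. -/
theorem exp_mul_jordanFactor_line {a b κ : ℝ} (hb : b ≠ 0) (γ : ℕ → ℂ) (u t s : ℝ) (z : ℂ) :
    Complex.exp (z * (t + s * (2 * u - a) : ℝ) + height a b κ z * (-b * s : ℝ)) *
      jordanFactor (slope a b z) b γ (t + s * (2 * u - a)) (-b * s) =
    Complex.exp (s * (u ^ 2 - κ) : ℝ) * lineTerm γ u t s z := by
  have hb' : (b : ℂ) ≠ 0 := Complex.ofReal_ne_zero.2 hb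
  rw [lineTerm, ← mul_assoc, ← Complex.exp_add]
  have e1 : z * (t + s * (2 * u - a) : ℝ) + height a b κ z * (-b * s : ℝ) =
      (s * (u ^ 2 - κ) : ℝ) + (z * t - s * (z - u) ^ 2) := by
    rw [height]; push_cast; field_simp; ring
  have e2 : ((t + s * (2 * u - a) : ℝ) : ℂ) + slope a b z * ((-b * s : ℝ) : ℂ) =
      t + 2 * s * (u - z) := by
    rw [slope]; push_cast; field_simp; ring
  have e3 : ((-b * s : ℝ) : ℂ) / b = -s := by
    push_cast; field_simp
  rw [e1, jordanFactor, e2, e3]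
  ring

theorem tendsto_pow_mul_exp_neg_mul {δ : ℝ} (hδ : 0 < δ) (j : ℕ) :
    Tendsto (fun s : ℝ => s ^ j * Real.exp (-δ * s)) atTop (𝓝 0) := by
  simpa using tendsto_rpow_mul_exp_neg_mul_atTop_nhds_zero j δ hδ

/-- Terms of smaller exponential growth are negligible. -/
theorem tendsto_lineTerm_zero (γ : ℕ → ℂ) (u t M : ℝ) (z : ℂ) (k : ℕ)
    (hz : z.im ^ 2 - (z.re - u) ^ 2 < M) :
    Tendsto (fun s : ℝ => Complex.exp (-(s * M : ℝ)) * lineTerm γ u t s z / (s : ℂ) ^ k) atTop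
      (𝓝 0) := by
  set δ := M - (z.im ^ 2 - (z.re - u) ^ 2) with hδ
  have hδ0 : 0 < δ := by linarith
  have hexp : ∀ (j : ℕ) (x : ℂ), Tendsto (fun s : ℝ => ‖Complex.exp (-(s * M : ℝ)) *
      Complex.exp (z * t - s * (z - u) ^ 2) * (x * (s : ℂ) ^ j)‖) atTop (𝓝 0) := by
    intro j x
    have h1 := (tendsto_pow_mul_exp_neg_mul hδ0 j).const_mul (Real.exp (z.re * t) * ‖x‖)
    rw [mul_zero] at h1
    refine h1.congr' ?_
    filter_upwards [eventually_ge_atTop 0] with s hs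
    rw [norm_mul, norm_mul, norm_mul, norm_pow, Complex.norm_exp, Complex.norm_exp,
      Complex.norm_real, Real.norm_of_nonneg hs, ← Real.exp_add]
    have : (-((s * M : ℝ) : ℂ)).re + (z * t - s * (z - u) ^ 2).re = z.re * t + -δ * s := by
      rw [pow_two]
      simp [hδ]
      ring
    rw [this, Real.exp_add]
    ring
  have hpoly : ∃ x₀ x₁ x₂ x₃ : ℂ, ∀ s : ℝ, lineTerm γ u t s z =
      Complex.exp (z * t - s * (z - u) ^ 2) *
        (x₀ * (s : ℂ) ^ 0 + x₁ * (s : ℂ) ^ 1 + x₂ * (s : ℂ) ^ 2 + x₃ * (s : ℂ) ^ 3) := by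
    refine ⟨γ 0 + γ 1 * t + γ 2 * (t ^ 2 / 2) + γ 3 * (t ^ 3 / 6),
      γ 1 * (2 * (u - z)) + γ 2 * (t * (2 * (u - z)) - 1) +
        γ 3 * (t ^ 2 * (2 * (u - z)) / 2 - t),
      γ 2 * ((2 * (u - z)) ^ 2 / 2) + γ 3 * (t * (2 * (u - z)) ^ 2 / 2 - (2 * (u - z))),
      γ 3 * ((2 * (u - z)) ^ 3 / 6), fun s => ?_⟩
    rw [lineTerm]; ring
  obtain ⟨x₀, x₁, x₂, x₃, hx⟩ := hpoly
  have hsum := (((hexp 0 x₀).add (hexp 1 x₁)).add (hexp 2 x₂)).add (hexp 3 x₃)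
  simp only [add_zero] at hsum
  refine squeeze_zero_norm' ?_ hsum
  filter_upwards [eventually_ge_atTop 1] with s hs
  have hs' : (1 : ℝ) ≤ ‖(s : ℂ) ^ k‖ := by
    rw [norm_pow, Complex.norm_real, Real.norm_of_nonneg (by linarith)]
    exact one_le_pow₀ hs
  rw [norm_div]
  refine (div_le_self (norm_nonneg _) hs').trans ?_
  rw [hx, ← mul_assoc, mul_add, mul_add, mul_add]
  exact (norm_add_le _ _).trans (add_le_add ((norm_add_le _ _).trans
    (add_le_add (norm_add_le _ _) le_rfl)) le_rfl)

theorem tendsto_pow_div_pow_atTop {j k : ℕ} (h : j < k) :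
    Tendsto (fun s : ℝ => (s : ℂ) ^ j / (s : ℂ) ^ k) atTop (𝓝 0) := by
  have h1 : Tendsto (fun s : ℝ => (((s ^ (k - j))⁻¹ : ℝ) : ℂ)) atTop (𝓝 ((0 : ℝ) : ℂ)) :=
    (Complex.continuous_ofReal.tendsto 0).comp
      (tendsto_inv_atTop_zero.comp (tendsto_pow_atTop (Nat.sub_ne_zero_of_lt h)))
  rw [Complex.ofReal_zero] at h1
  refine h1.congr' ?_
  filter_upwards [eventually_gt_atTop 0] with s hs
  have hs' : (s : ℂ) ≠ 0 := Complex.ofReal_ne_zero.2 hs.ne'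
  obtain ⟨m, rfl⟩ := Nat.exists_eq_add_of_lt h
  have : j + m + 1 - j = m + 1 := by omega
  rw [this]
  push_cast
  field_simp
  ring

theorem tendsto_cubic_div_pow {x : ℕ → ℂ} {k : ℕ} (hk : k < 4)
    (h : ∀ j, k < j → j < 4 → x j = 0) :
    Tendsto (fun s : ℝ => (∑ j ∈ Finset.range 4, x j * (s : ℂ) ^ j) / (s : ℂ) ^ k) atTop
      (𝓝 (x k)) := by
  have h1 : ∀ j ∈ Finset.range 4, Tendsto (fun s : ℝ => x j * (s : ℂ) ^ j / (s : ℂ) ^ k) atTop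
      (𝓝 (if j = k then x k else 0)) := by
    intro j hj
    rcases lt_trichotomy j k with hjk | hjk | hjk
    · have := (tendsto_pow_div_pow_atTop hjk).const_mul (x j)
      simpa [hjk.ne, mul_div_assoc] using this
    · subst hjk
      rw [if_pos rfl]
      refine tendsto_const_nhds.congr' ?_
      filter_upwards [eventually_gt_atTop 0] with s hs
      have hs' : (s : ℂ) ≠ 0 := Complex.ofReal_ne_zero.2 hs.ne'
      field_simp
    · simp [h j hjk (Finset.mem_range.1 hj), hjk.ne']
  have h2 := tendsto_finsetSum _ h1
  rw [Finset.sum_ite_eq' (Finset.range 4) k, if_pos (Finset.mem_range.2 hk)] at h2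
  refine h2.congr fun s => ?_
  rw [Finset.sum_div]

/-- The coefficients of the polynomial factor of `lineTerm` as a polynomial in `s`. -/
noncomputable def lineCoeff (γ : ℕ → ℂ) (t : ℝ) (β : ℂ) (j : ℕ) : ℂ :=
  if j = 0 then γ 0 + γ 1 * t + γ 2 * (t ^ 2 / 2) + γ 3 * (t ^ 3 / 6)
  else if j = 1 then γ 1 * β + γ 2 * (t * β - 1) + γ 3 * (t ^ 2 * β / 2 - t)
  else if j = 2 then γ 2 * (β ^ 2 / 2) + γ 3 * (t * β ^ 2 / 2 - β)
  else γ 3 * (β ^ 3 / 6)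

/-- Each γ j enters with degree at most j in s, and its part of degree j comes from (sβ)^j / j!. -/
theorem lineCoeff_of_forall_eq_zero {γ : ℕ → ℂ} {t : ℝ} {β : ℂ} {k : ℕ} (hk : k < 4)
    (hγ : ∀ j, k < j → j < 4 → γ j = 0) :
    (∀ j, k < j → j < 4 → lineCoeff γ t β j = 0) ∧
      lineCoeff γ t β k = γ k * β ^ k / k.factorial := by
  have a1 := hγ 1
  have a2 := hγ 2
  have a3 := hγ 3
  interval_cases k <;> simp at a1 a2 a3 <;> refine ⟨fun j h1 h2 => ?_, ?_⟩ <;>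
    first
      | (interval_cases j <;> simp [lineCoeff, a1, a2, a3])
      | (simp [lineCoeff, a1, a2, a3, Nat.factorial] <;> ring_nf)

theorem lineTerm_eq (γ : ℕ → ℂ) (u t s : ℝ) (z : ℂ) :
    lineTerm γ u t s z = Complex.exp (z * t - s * (z - u) ^ 2) *
      ∑ j ∈ Finset.range 4, lineCoeff γ t (2 * (u - z)) j * (s : ℂ) ^ j := by
  simp only [lineTerm, lineCoeff, Finset.sum_range_succ, Finset.sum_range_zero]
  norm_num
  ring

/-- The leading behaviour of a term of maximal exponential growth. -/
theorem tendsto_lineTerm_lead {γ : ℕ → ℂ} {u t M : ℝ} {z : ℂ} {k : ℕ} (hk : k < 4)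
    (hγ : ∀ j, k < j → j < 4 → lineCoeff γ t (2 * (u - z)) j = 0) (hz : -(z - u) ^ 2 = M) :
    Tendsto (fun s : ℝ => Complex.exp (-(s * M : ℝ)) * lineTerm γ u t s z / (s : ℂ) ^ k) atTop
      (𝓝 (Complex.exp (z * t) * lineCoeff γ t (2 * (u - z)) k)) := by
  refine ((tendsto_cubic_div_pow hk hγ).const_mul _).congr fun s => ?_
  rw [lineTerm_eq, ← mul_assoc, ← Complex.exp_add, mul_div_assoc]
  congr 2
  push_cast
  rw [← hz]
  ring

theorem lineTerm_eq_zero {γ : ℕ → ℂ} (hγ : ∀ j < 4, γ j = 0) (u t s : ℝ) (z : ℂ) :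
    lineTerm γ u t s z = 0 := by
  simp [lineTerm, hγ]

/-- `P` marks the summands of growth rate exactly `M`; the others are absent or slower, so only the
leading coefficients of the marked ones survive. -/
theorem tendsto_sum_lineTerm {Z : Finset ℂ} {γ : ℂ → ℕ → ℂ} {u t M : ℝ} {k : ℕ} (hk : k < 4)
    (P : ℂ → Prop) [DecidablePred P]
    (hlow : ∀ z ∈ Z, ¬ P z → (∀ j < 4, γ z j = 0) ∨ z.im ^ 2 - (z.re - u) ^ 2 < M)
    (hlead : ∀ z ∈ Z, P z → -(z - u) ^ 2 = (M : ℂ) ∧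
      ∀ j, k < j → j < 4 → lineCoeff (γ z) t (2 * (u - z)) j = 0) :
    Tendsto (fun s : ℝ => Complex.exp (-(s * M : ℝ)) *
      (∑ z ∈ Z, lineTerm (γ z) u t s z) / (s : ℂ) ^ k) atTop
      (𝓝 (∑ z ∈ Z with P z, Complex.exp (z * t) * lineCoeff (γ z) t (2 * (u - z)) k)) := by
  rw [Finset.sum_filter]
  refine (tendsto_finsetSum (f := fun z (s : ℝ) =>
    Complex.exp (-(s * M : ℝ)) * lineTerm (γ z) u t s z / (s : ℂ) ^ k) Z fun z hz => ?_).congr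
    fun s => ?_
  · by_cases hP : P z
    · rw [if_pos hP]
      exact tendsto_lineTerm_lead hk (hlead z hz hP).2 (hlead z hz hP).1
    · rw [if_neg hP]
      rcases hlow z hz hP with h0 | h0
      · simp [lineTerm_eq_zero h0]
      · exact tendsto_lineTerm_zero _ _ _ _ _ _ h0
  · rw [Finset.mul_sum, Finset.sum_div]

theorem limit_nonneg {S : ℝ → ℂ} (hS : ∀ s, (S s).im = 0 ∧ 0 < (S s).re) {M : ℝ} {k : ℕ} {L : ℂ}
    (h : Tendsto (fun s : ℝ => Complex.exp (-(s * M : ℝ)) * S s / (s : ℂ) ^ k) atTop (𝓝 L)) :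
    L.im = 0 ∧ 0 ≤ L.re := by
  have hform : ∀ s : ℝ, Complex.exp (-(s * M : ℝ)) * S s / (s : ℂ) ^ k =
      ((Real.exp (-(s * M)) * (S s).re / s ^ k : ℝ) : ℂ) := by
    intro s
    have : S s = ((S s).re : ℂ) := Complex.ext (by simp) (by simp [(hS s).1])
    rw [this]
    push_cast
    simp
  simp only [hform] at h
  constructor
  · have h1 := (Complex.continuous_im.tendsto L).comp h
    simp only [Function.comp_def, Complex.ofReal_im] at h1
    exact (tendsto_nhds_unique h1 tendsto_const_nhds)
  · have h1 := (Complex.continuous_re.tendsto L).comp h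
    simp only [Function.comp_def, Complex.ofReal_re] at h1
    refine ge_of_tendsto h1 ?_
    filter_upwards [eventually_ge_atTop 0] with s hs
    have := (hS s).2
    positivity

/-- A trigonometric polynomial without constant term is not nonnegative. -/
theorem eq_zero_of_trigonometric_nonneg {u v : ℝ} (hv : v ≠ 0) {x y : ℂ}
    (h : ∀ t : ℝ, (Complex.exp ((u + v * Complex.I) * t) * x +
      Complex.exp ((u - v * Complex.I) * t) * y).im = 0 ∧
      0 ≤ (Complex.exp ((u + v * Complex.I) * t) * x +
      Complex.exp ((u - v * Complex.I) * t) * y).re) : x = 0 ∧ y = 0 := by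
  have hv' : (v : ℂ) ≠ 0 := Complex.ofReal_ne_zero.2 hv
  have key : ∀ r : ℝ,
      (Complex.exp (r * Complex.I) * x + Complex.exp (-(r * Complex.I)) * y).im = 0 ∧
      0 ≤ (Complex.exp (r * Complex.I) * x + Complex.exp (-(r * Complex.I)) * y).re := by
    intro r
    have h1 := h (r / v)
    have e1 : (u + v * Complex.I) * ((r / v : ℝ) : ℂ) =
        ((u * (r / v) : ℝ) : ℂ) + r * Complex.I := by
      push_cast; field_simp
    have e2 : (u - v * Complex.I) * ((r / v : ℝ) : ℂ) =
        ((u * (r / v) : ℝ) : ℂ) + -(r * Complex.I) := by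
      push_cast; field_simp; ring
    rw [e1, e2, Complex.exp_add, Complex.exp_add, mul_assoc, mul_assoc, ← mul_add,
      ← Complex.ofReal_exp, Complex.im_ofReal_mul, Complex.re_ofReal_mul] at h1
    have hp := Real.exp_pos (u * (r / v))
    exact ⟨by simpa [hp.ne'] using h1.1, nonneg_of_mul_nonneg_right h1.2 hp⟩
  -- The function changes sign under r ↦ r + π, so nonnegativity at these four points makes it
  -- vanish at 0 and π/2: x + y = 0 and x - y = 0.
  have h0 := key 0
  have h1 := key Real.pi
  have h2 := key (Real.pi / 2)
  have h3 := key (-(Real.pi / 2))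
  have p1 : Complex.exp (-(Real.pi * Complex.I)) = -1 := by
    rw [Complex.exp_neg, Complex.exp_pi_mul_I]; norm_num
  have p2 : Complex.exp (((Real.pi / 2 : ℝ) : ℂ) * Complex.I) = Complex.I := by
    push_cast; exact Complex.exp_pi_div_two_mul_I
  have p3 : Complex.exp (-(((Real.pi / 2 : ℝ) : ℂ) * Complex.I)) = -Complex.I := by
    rw [Complex.exp_neg, p2, Complex.inv_I]
  rw [Complex.ofReal_neg, neg_mul, neg_neg, p2, p3] at h3
  rw [p2, p3] at h2
  rw [Complex.exp_pi_mul_I, p1] at h1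
  simp at h0 h1 h2 h3
  exact ⟨Complex.ext (by simp; linarith) (by simp; linarith),
    Complex.ext (by simp; linarith) (by simp; linarith)⟩

theorem coeff_eq_zero_of_affine_nonneg {x y : ℂ}
    (h : ∀ t : ℝ, (x + y * t).im = 0 ∧ 0 ≤ (x + y * t).re) :
    y = 0 ∧ x.im = 0 ∧ 0 ≤ x.re := by
  have h0 := h 0
  have h1 := h 1
  simp at h0 h1
  refine ⟨Complex.ext ?_ (by simp; linarith), h0⟩
  by_contra hne
  simp at hne
  -- At this argument the real part is -1.
  have h2 := (h (-(x.re + 1) / y.re)).2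
  simp at h2
  rw [mul_div_cancel₀ _ hne] at h2
  linarith

/-- Nonreal frequencies do not occur in a positive solution. -/
theorem coeff_eq_zero_of_im_ne_zero {Z : Finset ℂ} {γ : ℂ → ℕ → ℂ}
    (hconj : ∀ z ∈ Z, (starRingEnd ℂ) z ∈ Z)
    (hpos : ∀ u t s : ℝ, (∑ z ∈ Z, lineTerm (γ z) u t s z).im = 0 ∧
      0 < (∑ z ∈ Z, lineTerm (γ z) u t s z).re) :
    ∀ z ∈ Z, z.im ≠ 0 → ∀ j < 4, γ z j = 0 := by
  classical
  by_contra hcon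
  push Not at hcon
  let B := Z.filter fun z => z.im ≠ 0 ∧ ∃ j < 4, γ z j ≠ 0
  obtain ⟨z₀, hz₀, hmax⟩ := B.exists_max_image (fun z => z.im ^ 2) (by
    obtain ⟨z, hz, h1, h2⟩ := hcon
    exact ⟨z, Finset.mem_filter.2 ⟨hz, h1, h2⟩⟩)
  obtain ⟨hz₀Z, him, j₀, hj₀, hne⟩ := Finset.mem_filter.1 hz₀
  set z₁ := (starRingEnd ℂ) z₀ with hz₁
  have hz₁Z : z₁ ∈ Z := hconj _ hz₀Z
  have hne01 : z₀ ≠ z₁ := fun h => him (by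
    have := congrArg Complex.im h
    simp [hz₁] at this
    linarith)
  have d0 : (z₀.re : ℂ) - z₀ = -(z₀.im * Complex.I) := by
    apply Complex.ext <;> simp
  have d1 : (z₀.re : ℂ) - z₁ = z₀.im * Complex.I := by
    apply Complex.ext <;> simp [hz₁]
  have hlow : ∀ z ∈ Z, ¬ (z = z₀ ∨ z = z₁) → (∀ j < 4, γ z j = 0) ∨
      z.im ^ 2 - (z.re - z₀.re) ^ 2 < z₀.im ^ 2 := by
    intro z hz hP
    by_cases h0 : ∀ j < 4, γ z j = 0
    · exact Or.inl h0
    right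
    push Not at h0
    have hsq : 0 < z₀.im ^ 2 := by positivity
    by_cases hzim : z.im = 0
    · rw [hzim]; nlinarith [sq_nonneg (z.re - z₀.re)]
    have hle : z.im ^ 2 ≤ z₀.im ^ 2 := hmax z (Finset.mem_filter.2 ⟨hz, hzim, h0⟩)
    by_cases hre : z.re = z₀.re
    · have hne2 : z.im ^ 2 ≠ z₀.im ^ 2 := by
        intro h
        rcases sq_eq_sq_iff_eq_or_eq_neg.1 h with h | h
        · exact hP (Or.inl (Complex.ext hre h))
        · exact hP (Or.inr (Complex.ext (by simp [hz₁, hre]) (by simp [hz₁, h])))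
      rw [hre, sub_self]
      have := lt_of_le_of_ne hle hne2
      linarith
    · have : 0 < (z.re - z₀.re) ^ 2 := by
        have := sub_ne_zero.2 hre
        positivity
      linarith
  -- Descending elimination: once the higher coefficients vanish, the limit is an oscillating
  -- function of t that is nonnegative. The factors 2(u - z) are nonzero, so no coefficient escapes.
  have step : ∀ k < 4, (∀ j, k < j → j < 4 → γ z₀ j = 0 ∧ γ z₁ j = 0) →
      γ z₀ k = 0 ∧ γ z₁ k = 0 := by
    intro k hk hhigh
    have hβ0 : 2 * ((z₀.re : ℂ) - z₀) ≠ 0 := by rw [d0]; simp [him]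
    have hβ1 : 2 * ((z₀.re : ℂ) - z₁) ≠ 0 := by rw [d1]; simp [him]
    have hlc := fun δ t β => lineCoeff_of_forall_eq_zero (γ := δ) (t := t) (β := β) hk
    have hh0 : ∀ j, k < j → j < 4 → γ z₀ j = 0 := fun j h1 h2 => (hhigh j h1 h2).1
    have hh1 : ∀ j, k < j → j < 4 → γ z₁ j = 0 := fun j h1 h2 => (hhigh j h1 h2).2
    have hfil : Z.filter (fun z => z = z₀ ∨ z = z₁) = {z₀, z₁} := by
      ext z
      simp only [Finset.mem_filter, Finset.mem_insert, Finset.mem_singleton]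
      constructor
      · exact fun h => h.2
      · rintro (h | h)
        · exact ⟨h ▸ hz₀Z, Or.inl h⟩
        · exact ⟨h ▸ hz₁Z, Or.inr h⟩
    have hlim : ∀ t : ℝ, (Complex.exp (z₀ * t) * (γ z₀ k * (2 * (z₀.re - z₀)) ^ k / k.factorial) +
        Complex.exp (z₁ * t) * (γ z₁ k * (2 * (z₀.re - z₁)) ^ k / k.factorial)).im = 0 ∧
        0 ≤ (Complex.exp (z₀ * t) * (γ z₀ k * (2 * (z₀.re - z₀)) ^ k / k.factorial) +
        Complex.exp (z₁ * t) * (γ z₁ k * (2 * (z₀.re - z₁)) ^ k / k.factorial)).re := by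
      intro t
      have h1 := tendsto_sum_lineTerm (t := t) hk (fun z => z = z₀ ∨ z = z₁) hlow (by
        rintro z hz (rfl | rfl)
        · refine ⟨?_, (hlc _ _ _ hh0).1⟩
          rw [← neg_sub, d0, neg_neg, mul_pow, Complex.I_sq]; push_cast; ring
        · refine ⟨?_, (hlc _ _ _ hh1).1⟩
          rw [← neg_sub, d1, neg_sq, mul_pow, Complex.I_sq]; push_cast; ring)
      have h2 := limit_nonneg (fun s => hpos z₀.re t s) h1
      rwa [hfil, Finset.sum_pair hne01, (hlc _ _ _ hh0).2, (hlc _ _ _ hh1).2] at h2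
    have e0 : z₀ = z₀.re + z₀.im * Complex.I := (Complex.re_add_im z₀).symm
    have e1 : z₁ = z₀.re - z₀.im * Complex.I := by
      apply Complex.ext <;> simp [hz₁]
    have := eq_zero_of_trigonometric_nonneg him (u := z₀.re)
      (x := γ z₀ k * (2 * (z₀.re - z₀)) ^ k / k.factorial)
      (y := γ z₁ k * (2 * (z₀.re - z₁)) ^ k / k.factorial) (fun t => by
        rw [← e0, ← e1]; exact hlim t)
    have hf : (k.factorial : ℂ) ≠ 0 := Nat.cast_ne_zero.2 k.factorial_ne_zero
    simpa [hf, hβ0, hβ1, pow_ne_zero] using this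
  have s3 := step 3 (by norm_num) (fun j h1 h2 => by omega)
  have s2 := step 2 (by norm_num) (fun j h1 h2 => by
    interval_cases j; exact s3)
  have s1 := step 1 (by norm_num) (fun j h1 h2 => by
    interval_cases j; exacts [s2, s3])
  have s0 := step 0 (by norm_num) (fun j h1 h2 => by
    interval_cases j; exacts [s1, s2, s3])
  interval_cases j₀
  exacts [hne s0.1, hne s1.1, hne s2.1, hne s3.1]

/-- Real frequencies occur in a positive solution of at most polynomial growth without
polynomial factors and with nonnegative coefficients. -/
theorem coeff_nonneg_of_im_eq_zero {Z : Finset ℂ} {γ : ℂ → ℕ → ℂ}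
    (hreal : ∀ z ∈ Z, z.im ≠ 0 → ∀ j < 4, γ z j = 0)
    (hpos : ∀ u t s : ℝ, (∑ z ∈ Z, lineTerm (γ z) u t s z).im = 0 ∧
      0 < (∑ z ∈ Z, lineTerm (γ z) u t s z).re)
    (hgrow : ∀ u x : ℝ, Tendsto (fun s : ℝ => (∑ z ∈ Z, lineTerm (γ z) u 0 s z).re / s) atTop
      (𝓝 x) → x = 0) :
    ∀ z ∈ Z, z.im = 0 → γ z 1 = 0 ∧ γ z 2 = 0 ∧ γ z 3 = 0 ∧ (γ z 0).im = 0 ∧ 0 ≤ (γ z 0).re := by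
  classical
  intro z hz him
  have hzr : (z.re : ℂ) - z = 0 := Complex.ext (by simp) (by simp [him])
  have hlow : ∀ y ∈ Z, ¬ (y = z) → (∀ j < 4, γ y j = 0) ∨
      y.im ^ 2 - (y.re - z.re) ^ 2 < 0 := by
    intro y hy hyz
    by_cases hyim : y.im = 0
    · right
      have : y.re - z.re ≠ 0 := fun h => hyz (Complex.ext (by linarith) (by rw [hyim, him]))
      rw [hyim]
      have : 0 < (y.re - z.re) ^ 2 := by positivity
      linarith
    · exact Or.inl (hreal y hy hyim)
  have hfil : Z.filter (fun y => y = z) = {z} := by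
    ext y
    simp only [Finset.mem_filter, Finset.mem_singleton]
    exact ⟨fun h => h.2, fun h => ⟨h ▸ hz, h⟩⟩
  have hlim : ∀ (t : ℝ) (k : ℕ), k < 4 →
      (∀ j, k < j → j < 4 → lineCoeff (γ z) t 0 j = 0) →
      Tendsto (fun s : ℝ => Complex.exp (-(s * (0 : ℝ) : ℝ)) *
        (∑ y ∈ Z, lineTerm (γ y) z.re t s y) / (s : ℂ) ^ k) atTop
        (𝓝 (Complex.exp (z * t) * lineCoeff (γ z) t 0 k)) := by
    intro t k hk h
    have := tendsto_sum_lineTerm (t := t) hk (fun y => y = z) hlow (by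
      rintro y hy rfl
      rw [hzr, mul_zero, ← neg_sub, hzr]
      exact ⟨by simp, h⟩)
    rwa [hfil, Finset.sum_singleton, hzr, mul_zero] at this
  have hsign : ∀ (t : ℝ) (k : ℕ), k < 4 →
      (∀ j, k < j → j < 4 → lineCoeff (γ z) t 0 j = 0) →
      (lineCoeff (γ z) t 0 k).im = 0 ∧ 0 ≤ (lineCoeff (γ z) t 0 k).re := by
    intro t k hk h
    have h1 := limit_nonneg (fun s => hpos z.re t s) (hlim t k hk h)
    have h2 : Complex.exp (z * t) = ((Real.exp (z.re * t) : ℝ) : ℂ) := by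
      have : z = (z.re : ℂ) := Complex.ext (by simp) (by simp [him])
      rw [this]; push_cast; simp
    rw [h2, Complex.im_ofReal_mul, Complex.re_ofReal_mul] at h1
    have hp := Real.exp_pos (z.re * t)
    exact ⟨by simpa [hp.ne'] using h1.1, nonneg_of_mul_nonneg_right h1.2 hp⟩
  -- With `u = z` the shift 2(u - z) is zero, so the factor is at most linear in s, with slope -γ₂ -
  -- γ₃t.
  have hhigh : ∀ t : ℝ, ∀ j, 1 < j → j < 4 → lineCoeff (γ z) t 0 j = 0 := by
    intro t j h1 h2
    interval_cases j <;> simp [lineCoeff]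
  have h3 := coeff_eq_zero_of_affine_nonneg (x := -γ z 2) (y := -γ z 3) (fun t => by
    have := hsign t 1 (by norm_num) (hhigh t)
    have e : lineCoeff (γ z) t 0 1 = -γ z 2 + -γ z 3 * t := by
      simp [lineCoeff]
    rwa [e] at this)
  have g3 : γ z 3 = 0 := neg_eq_zero.1 h3.1
  have g2 : γ z 2 = 0 := by
    -- Positivity only gives -γ₂ ≥ 0; excluding linear growth gives equality.
    have h4 := hlim 0 1 (by norm_num) (hhigh 0)
    have h5 := (Complex.continuous_re.tendsto _).comp h4
    have h6 : (-γ z 2).re = 0 := by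
      refine hgrow z.re _ ?_
      have e : (Complex.exp (z * (0 : ℝ)) * lineCoeff (γ z) 0 0 1).re = (-γ z 2).re := by
        simp [lineCoeff]
      rw [e] at h5
      refine h5.congr fun s => ?_
      simp only [Function.comp_def, mul_zero, Complex.ofReal_zero, neg_zero, Complex.exp_zero,
        one_mul, pow_one]
      rw [Complex.div_ofReal_re]
    have := Complex.ext (z := -γ z 2) (w := 0) (by simpa using h6) (by simpa using h3.2.1)
    exact neg_eq_zero.1 this
  have h0 := coeff_eq_zero_of_affine_nonneg (x := γ z 0) (y := γ z 1) (fun t => by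
    have := hsign t 0 (by norm_num) (by
      intro j h1 h2
      interval_cases j <;> simp [lineCoeff, g2, g3])
    have e : lineCoeff (γ z) t 0 0 = γ z 0 + γ z 1 * t := by
      simp [lineCoeff, g2, g3]
    rwa [e] at this)
  exact ⟨h0.1, g2, g3, h0.2⟩

end Positivity

end NEF

namespace NEF

open Set Filter Topology ProbabilityTheory

/-! ### Analytic continuation and the domain of the Laplace transform. -/

section Domain

/-- A moment generating function which continues analytically to a disc around the origin is finite
on the real part of the disc. -/
theorem integrable_exp_mul_of_hasFPowerSeriesOnBall {Ω : Type*} [MeasurableSpace Ω]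
    {ν : Measure Ω} {X : Ω → ℝ} (hX : Measurable X)
    (h0 : 0 ∈ interior (integrableExpSet X ν)) {G : ℝ → ℝ} {q : FormalMultilinearSeries ℝ ℝ ℝ}
    {R : ENNReal} (hG : HasFPowerSeriesOnBall G q 0 R) (heq : mgf X ν =ᶠ[𝓝 0] G)
    {s : NNReal} (hs : (s : ENNReal) < R) : Integrable (fun ω => Real.exp (s * X ω)) ν := by
  -- The Taylor coefficients are the moments over factorials, so the moment series converges in the
  -- whole disc. Even moments are nonnegative, and Tonelli sums them to the integral of cosh.
  have hq := (hasFPowerSeriesAt_mgf h0).eq_formalMultilinearSeries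
    (hG.hasFPowerSeriesAt.congr heq.symm)
  have hsum := q.summable_norm_mul_pow (hs.trans_le hG.r_le)
  rw [← hq] at hsum
  simp only [FormalMultilinearSeries.ofScalars_norm, zero_mul, Real.exp_zero, mul_one] at hsum
  have hsum2 : Summable fun n : ℕ =>
      (∫ ω, X ω ^ (2 * n) ∂ν) / (2 * n).factorial * (s : ℝ) ^ (2 * n) := by
    refine Summable.of_norm_bounded (hsum.comp_injective (i := fun n : ℕ => 2 * n)
      (fun m n h => by simpa using h)) fun n => ?_
    simp [norm_mul]
  have hint : ∀ n : ℕ, Integrable (fun ω => X ω ^ (2 * n)) ν := fun n =>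
    integrable_pow_of_mem_interior_integrableExpSet h0 _
  have hnn : ∀ (n : ℕ) (ω : Ω), 0 ≤ (s * X ω) ^ (2 * n) / (2 * n).factorial := fun n ω => by
    rw [pow_mul]; positivity
  have hlint : ∫⁻ ω, ENNReal.ofReal (Real.cosh (s * X ω)) ∂ν < ⊤ := by
    have e1 : ∀ ω, ENNReal.ofReal (Real.cosh (s * X ω)) =
        ∑' n : ℕ, ENNReal.ofReal ((s * X ω) ^ (2 * n) / (2 * n).factorial) := fun ω => by
      rw [← (Real.hasSum_cosh (s * X ω)).tsum_eq,
        ENNReal.ofReal_tsum_of_nonneg (fun n => hnn n ω) (Real.hasSum_cosh _).summable]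
    have e2 : ∀ n : ℕ, ∫⁻ ω, ENNReal.ofReal ((s * X ω) ^ (2 * n) / (2 * n).factorial) ∂ν =
        ENNReal.ofReal ((∫ ω, X ω ^ (2 * n) ∂ν) / (2 * n).factorial * (s : ℝ) ^ (2 * n)) := by
      intro n
      have e3 : (fun ω => (s * X ω) ^ (2 * n) / ((2 * n).factorial : ℝ)) =
          fun ω => ((s : ℝ) ^ (2 * n) / (2 * n).factorial) * X ω ^ (2 * n) := by
        ext ω; rw [mul_pow]; ring
      rw [← ofReal_integral_eq_lintegral_ofReal (by rw [e3]; exact (hint n).const_mul _)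
        (Filter.Eventually.of_forall (hnn n)), e3, integral_const_mul]
      congr 1
      ring
    simp only [e1]
    rw [lintegral_tsum (fun n => by fun_prop)]
    simp only [e2]
    rw [← ENNReal.ofReal_tsum_of_nonneg (fun n => ?_) hsum2]
    · exact ENNReal.ofReal_lt_top
    · have : 0 ≤ ∫ ω, X ω ^ (2 * n) ∂ν := integral_nonneg fun ω => by
        simp only [pow_mul]; positivity
      positivity
  have hcosh : Integrable (fun ω => Real.cosh (s * X ω)) ν := by
    refine ⟨(Real.continuous_cosh.measurable.comp (hX.const_mul _)).aestronglyMeasurable, ?_⟩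
    rw [hasFiniteIntegral_iff_ofReal (Filter.Eventually.of_forall fun ω => (Real.cosh_pos _).le)]
    exact hlint
  refine Integrable.mono' (hcosh.const_mul 2) (by fun_prop)
    (Filter.Eventually.of_forall fun ω => ?_)
  rw [Real.norm_of_nonneg (Real.exp_pos _).le, Real.cosh_eq]
  have := Real.exp_pos (-(s * X ω))
  linarith

variable {n : ℕ} {μ : Measure (EuclideanSpace ℝ (Fin n))}

/-- Analytic continuation of the Laplace transform along a line extends its domain. -/
theorem integrable_exp_inner_add_smul [NeZero μ] {θ u : EuclideanSpace ℝ (Fin n)}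
    (hθ : θ ∈ laplaceDomain μ) {G : ℝ → ℝ} {q : FormalMultilinearSeries ℝ ℝ ℝ}
    {R : ENNReal} (hG : HasFPowerSeriesOnBall G q 0 R)
    (heq : ∀ᶠ t in 𝓝 (0 : ℝ), laplace μ (θ + t • u) = G t)
    {s : NNReal} (hs : (s : ENNReal) < R) :
    Integrable (fun x => Real.exp ⟪θ + (s : ℝ) • u, x⟫) μ := by
  have hθi := integrable_of_mem_laplaceDomain hθ
  -- Tilting moves the base point to 0: under `ν` the moment generating function of ⟪u, x⟫ is L(θ +
  -- tu) / L(θ).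
  set ν := μ.tilted fun x => ⟪θ, x⟫ with hν
  have hiff : ∀ t : ℝ, Integrable (fun x => Real.exp (t * ⟪u, x⟫)) ν ↔
      Integrable (fun x => Real.exp ⟪θ + t • u, x⟫) μ := by
    intro t
    rw [hν, integrable_tilted_iff hθi]
    refine iff_of_eq (congrArg (fun h => Integrable h μ) ?_)
    ext x
    rw [smul_eq_mul, ← Real.exp_add, inner_add_left, real_inner_smul_left]
  have hcont : Continuous fun t : ℝ => θ + t • u := by fun_prop
  have hev : ∀ᶠ t in 𝓝 (0 : ℝ), θ + t • u ∈ laplaceDomain μ :=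
    hcont.continuousAt.eventually_mem (isOpen_laplaceDomain.mem_nhds (by simpa using hθ))
  have h0 : 0 ∈ interior (integrableExpSet (fun x => ⟪u, x⟫) ν) := by
    rw [mem_interior_iff_mem_nhds]
    filter_upwards [hev] with t ht
    exact (hiff t).2 (integrable_of_mem_laplaceDomain ht)
  rw [← hiff]
  refine integrable_exp_mul_of_hasFPowerSeriesOnBall (by fun_prop) h0
    (hG.const_smul (c := (laplace μ θ)⁻¹)) ?_ hs
  filter_upwards [heq] with t ht
  rw [mgf, hν, integral_exp_tilted (fun x => ⟪θ, x⟫) (fun x => t * ⟪u, x⟫)]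
  simp only [Pi.add_apply, Pi.smul_apply, smul_eq_mul]
  rw [← ht, laplace, laplace, div_eq_inv_mul]
  simp only [inner_add_left, real_inner_smul_left]

/-- If the Laplace transform is the `p`-th power of a function which is analytic along all lines of
the space then it is finite everywhere. -/
theorem laplaceDomain_eq_univ [NeZero μ] (hne : (laplaceDomain μ).Nonempty) {p : ℝ} (hp : 0 < p)
    {φ : EuclideanSpace ℝ (Fin n) → ℝ} (hcont : Continuous φ)
    (hφ : ∀ θ u, AnalyticAt ℝ (fun t : ℝ => φ (θ + t • u)) 0)
    (hpos : ∀ θ ∈ laplaceDomain μ, 0 < φ θ)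
    (heq : ∀ θ ∈ laplaceDomain μ, laplace μ θ = φ θ ^ p) : laplaceDomain μ = Set.univ := by
  refine IsClopen.eq_univ ⟨isClosed_of_closure_subset fun θ hθ => ?_, isOpen_laplaceDomain⟩ hne
  have hφ0 : 0 ≤ φ θ := by
    have : closure (laplaceDomain μ) ⊆ {η | 0 ≤ φ η} :=
      closure_minimal (fun η hη => (hpos η hη).le) (isClosed_le continuous_const hcont)
    exact this hθ
  have hφpos : 0 < φ θ := by
    obtain ⟨x, hx, hlim⟩ := mem_closure_iff_seq_limit.1 hθ
    have hL : ∀ k, ∫⁻ y, ENNReal.ofReal (Real.exp ⟪x k, y⟫) ∂μ = ENNReal.ofReal (φ (x k) ^ p) := by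
      intro k
      rw [← heq _ (hx k), laplace, ofReal_integral_eq_lintegral_ofReal
        (integrable_of_mem_laplaceDomain (hx k))
        (Filter.Eventually.of_forall fun y => (Real.exp_pos _).le)]
    -- Fatou at the boundary point bounds the integral by φ(θ)^p; if φ(θ) were 0, the measure would
    -- vanish.
    have hfatou := lintegral_liminf_le (μ := μ) (u := atTop)
      (f := fun (k : ℕ) (y : EuclideanSpace ℝ (Fin n)) => ENNReal.ofReal (Real.exp ⟪x k, y⟫))
      (fun k => by fun_prop)
    have h1 : Tendsto (fun k => ENNReal.ofReal (φ (x k) ^ p)) atTop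
        (𝓝 (ENNReal.ofReal (φ θ ^ p))) := by
      refine (ENNReal.continuous_ofReal.tendsto _).comp ?_
      exact (((hcont.tendsto θ).comp hlim).rpow_const (Or.inr hp.le))
    have h2 : ∀ y, liminf (fun k => ENNReal.ofReal (Real.exp ⟪x k, y⟫)) atTop =
        ENNReal.ofReal (Real.exp ⟪θ, y⟫) := by
      intro y
      refine Tendsto.liminf_eq ?_
      have : Continuous fun η : EuclideanSpace ℝ (Fin n) =>
        ENNReal.ofReal (Real.exp ⟪η, y⟫) :=
        ENNReal.continuous_ofReal.comp (by fun_prop)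
      exact (this.tendsto θ).comp hlim
    simp only [hL, h2] at hfatou
    rw [h1.liminf_eq] at hfatou
    rcases hφ0.lt_or_eq with h | h
    · exact h
    · exfalso
      rw [← h, Real.zero_rpow hp.ne', ENNReal.ofReal_zero, nonpos_iff_eq_zero,
        lintegral_eq_zero_iff (by fun_prop)] at hfatou
      have : ∀ᵐ y ∂μ, False := by
        filter_upwards [hfatou] with y hy
        simp only [Pi.zero_apply, ENNReal.ofReal_eq_zero] at hy
        exact absurd hy (not_le.2 (Real.exp_pos _))
      simp only [eventually_false_iff_eq_bot, ae_eq_bot] at this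
      exact NeZero.ne μ this
  obtain ⟨θ₀, hθ₀⟩ := hne
  set u := θ - θ₀ with hu
  have hG : AnalyticAt ℝ (fun t : ℝ => φ (θ + t • u) ^ p) 0 := by
    have h1 := ((hφ θ u).log (by simpa using hφpos)).const_smul (c := p) |>.rexp'
    refine h1.congr ?_
    have hc : ContinuousAt (fun t : ℝ => φ (θ + t • u)) 0 := (hφ θ u).continuousAt
    filter_upwards [hc.eventually (lt_mem_nhds (by simpa using hφpos))] with t ht
    simp only [Pi.smul_apply, smul_eq_mul]
    rw [Real.rpow_def_of_pos ht, mul_comm]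
  obtain ⟨q, r, hq⟩ := hG
  -- Re-expansion at -δ has radius at least r - δ > δ, so a disc around the interior point θ₁
  -- reaches past θ. The bound δ ≤ 1 keeps θ₁ on the segment from θ₀ to θ.
  obtain ⟨δ, hδ0, hδr, hδ1⟩ : ∃ δ : NNReal, 0 < δ ∧ (δ : ENNReal) + δ < r ∧ δ ≤ 1 := by
    obtain ⟨ρ, hρ0, hρr⟩ := ENNReal.lt_iff_exists_nnreal_btwn.1 hq.r_pos
    refine ⟨min (ρ / 2) 1, lt_min (half_pos (by exact_mod_cast hρ0)) one_pos, ?_, min_le_right _ _⟩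
    refine lt_of_le_of_lt ?_ hρr
    rw [← ENNReal.coe_add]
    refine ENNReal.coe_le_coe.2 ?_
    calc min (ρ / 2) 1 + min (ρ / 2) 1 ≤ ρ / 2 + ρ / 2 :=
        add_le_add (min_le_left _ _) (min_le_left _ _)
      _ = ρ := add_halves ρ
  set θ₁ := θ + (-(δ : ℝ)) • u with hθ₁def
  have hθ₁ : θ₁ ∈ laplaceDomain μ := by
    have hδ1' : (δ : ℝ) ≤ 1 := by exact_mod_cast hδ1
    have hδ0' : (0 : ℝ) < δ := by exact_mod_cast hδ0
    rcases hδ1'.eq_or_lt with h | h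
    · have : θ₁ = θ₀ := by rw [hθ₁def, h, hu]; simp
      rwa [this]
    · have := convex_laplaceDomain (μ := μ) |>.openSegment_interior_closure_subset_interior
        (by rwa [isOpen_laplaceDomain.interior_eq]) hθ
      rw [isOpen_laplaceDomain.interior_eq] at this
      refine this ⟨δ, 1 - δ, hδ0', by linarith, by ring, ?_⟩
      rw [hθ₁def, hu]
      module
  have hnorm : (‖(-(δ : ℝ))‖₊ : ENNReal) = δ := by
    rw [nnnorm_neg]; congr 1; exact Real.nnnorm_of_nonneg δ.2
  have hq1 := hq.changeOrigin (y := -(δ : ℝ)) (by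
    rw [hnorm]; exact lt_of_le_of_lt le_self_add hδr)
  have hq2 := hq1.comp_sub (δ : ℝ)
  rw [hnorm, zero_add, neg_add_cancel] at hq2
  have hlt : (δ : ENNReal) < r - δ := by
    rw [lt_tsub_iff_right]; exact hδr
  obtain ⟨s, hs1, hs2⟩ := ENNReal.lt_iff_exists_nnreal_btwn.1 hlt
  have hs1' : (δ : ℝ) < s := by exact_mod_cast hs1
  have hint := integrable_exp_inner_add_smul (u := u) hθ₁ hq2 (by
    have hc : Continuous fun t : ℝ => θ₁ + t • u := by fun_prop
    have hev : ∀ᶠ t in 𝓝 (0 : ℝ), θ₁ + t • u ∈ laplaceDomain μ :=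
      hc.continuousAt.eventually_mem (isOpen_laplaceDomain.mem_nhds (by simpa using hθ₁))
    filter_upwards [hev] with t ht
    rw [heq _ ht]
    congr 2
    rw [hθ₁def]
    module) hs2
  -- θ lies strictly between the interior point θ₀ and a point of finiteness beyond θ, hence is
  -- interior.
  have hsub := convex_integrable_exp_inner (μ := μ) |>.openSegment_interior_self_subset_interior
    hθ₀ hint
  have hd : 0 < 1 + s - (δ : ℝ) := by linarith [s.2]
  refine hsub ⟨(s - δ) / (1 + s - δ), 1 / (1 + s - δ), div_pos (by linarith) hd, by positivity,
    by field_simp; ring, ?_⟩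
  have e1 : θ₁ + (s : ℝ) • u = θ₀ + (1 + s - δ : ℝ) • u := by
    rw [hθ₁def, hu]; module
  rw [e1, smul_add, smul_smul, one_div_mul_cancel hd.ne', one_smul, ← add_assoc, ← add_smul]
  have e2 : (s - δ : ℝ) / (1 + s - δ) + 1 / (1 + s - δ) = 1 := by field_simp; ring
  rw [e2, one_smul, hu]
  abel

end Domain

end NEF

namespace NEF

open Set Filter Topology ProbabilityTheory

/-! ### Growth of moment generating functions. -/

section Growth

variable {Ω : Type*} [MeasurableSpace Ω] {μ : Measure Ω} [IsFiniteMeasure μ] {Y : Ω → ℝ}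

/-- A random variable with moment generating function of subexponential growth is nonpositive. -/
theorem ae_nonpos_of_tendsto_mgf (hint : ∀ s, Integrable (fun ω => Real.exp (s * Y ω)) μ)
    (h : ∀ ε > 0, Tendsto (fun s => Real.exp (-ε * s) * mgf Y μ s) atTop (𝓝 0)) :
    ∀ᵐ ω ∂μ, Y ω ≤ 0 := by
  have hε : ∀ ε > 0, ∀ᵐ ω ∂μ, Y ω < ε := by
    intro ε hε
    have h1 : μ.real {ω | ε ≤ Y ω} ≤ 0 := by
      refine ge_of_tendsto (h ε hε) ?_
      filter_upwards [eventually_ge_atTop 0] with s hs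
      refine (measure_ge_le_exp_mul_mgf ε hs (hint s)).trans_eq ?_
      ring_nf
    have h2 : μ {ω | ε ≤ Y ω} = 0 := by
      have := le_antisymm h1 measureReal_nonneg
      rwa [measureReal_eq_zero_iff] at this
    rw [ae_iff]
    simpa using h2
  have h3 : ∀ᵐ ω ∂μ, ∀ k : ℕ, Y ω < 1 / ((k : ℝ) + 1) :=
    ae_all_iff.2 fun k => hε _ (by positivity)
  filter_upwards [h3] with ω hω
  exact ge_of_tendsto' tendsto_one_div_add_atTop_nhds_zero_nat fun k => (hω k).le

/-- A moment generating function cannot grow like a power. -/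
theorem eq_zero_of_mgf_eq_rpow (hint : ∀ s, Integrable (fun ω => Real.exp (s * Y ω)) μ)
    {p : ℝ} (hp : 0 < p) {S : ℝ → ℝ} (hS : ∀ s, 0 < S s) (hmgf : ∀ s, mgf Y μ s = S s ^ p) {x : ℝ}
    (hx : Tendsto (fun s => S s / s) atTop (𝓝 x)) : x = 0 := by
  have hx0 : 0 ≤ x := by
    refine ge_of_tendsto hx ?_
    filter_upwards [eventually_ge_atTop 0] with s hs
    exact div_nonneg (hS s).le hs
  -- Power growth is subexponential, so Y ≤ 0 almost surely; then the moment generating function is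
  -- bounded for s ≥ 0.
  have hY : ∀ᵐ ω ∂μ, Y ω ≤ 0 := by
    refine ae_nonpos_of_tendsto_mgf hint fun ε hε => ?_
    have h1 := (hx.rpow_const (p := p) (Or.inr hp.le)).mul
      (tendsto_rpow_mul_exp_neg_mul_atTop_nhds_zero p ε hε)
    rw [mul_zero] at h1
    refine h1.congr' ?_
    filter_upwards [eventually_gt_atTop 0] with s hs
    rw [hmgf, Real.div_rpow (hS s).le hs.le]
    have := (Real.rpow_pos_of_pos hs p).ne'
    field_simp
  have hbound : ∀ s, 0 ≤ s → S s ≤ (μ.real univ) ^ p⁻¹ := by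
    intro s hs
    have h1 : S s ^ p ≤ μ.real univ := by
      rw [← hmgf, mgf]
      calc ∫ ω, Real.exp (s * Y ω) ∂μ ≤ ∫ _, (1 : ℝ) ∂μ := by
            refine integral_mono_ae (hint s) (integrable_const _) ?_
            filter_upwards [hY] with ω hω
            exact Real.exp_le_one_iff.2 (mul_nonpos_of_nonneg_of_nonpos hs hω)
        _ = μ.real univ := by simp
    calc S s = (S s ^ p) ^ p⁻¹ := by rw [Real.rpow_rpow_inv (hS s).le hp.ne']
      _ ≤ _ := Real.rpow_le_rpow (Real.rpow_nonneg (hS s).le _) h1 (inv_nonneg.2 hp.le)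
  refine le_antisymm ?_ hx0
  have h2 : Tendsto (fun s : ℝ => (μ.real univ) ^ p⁻¹ / s) atTop (𝓝 0) :=
    tendsto_const_nhds.div_atTop tendsto_id
  refine le_of_tendsto_of_tendsto hx h2 ?_
  filter_upwards [eventually_ge_atTop 0] with s hs
  exact div_le_div_of_nonneg_right (hbound s hs) hs

end Growth

/-! ### Reduction to an exponential sum over the real roots. -/

section Coefficients

/-- The line on which the exponent of the frequency `l` has the slope `u² - κ - (l - u)²`. -/
noncomputable def linePoint (a b u t s : ℝ) : EuclideanSpace ℝ (Fin 2) :=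
  !₂[t + s * (2 * u - a), -b * s]

theorem inner_linePoint (a b u t s : ℝ) (x : EuclideanSpace ℝ (Fin 2)) :
    ⟪linePoint a b u t s, x⟫ = t * x 0 + s * ((2 * u - a) * x 0 - b * x 1) := by
  simp [linePoint, PiLp.inner_apply, Fin.sum_univ_two]
  ring

/-- The expression of `exists_laplace_representation`. -/
noncomputable def expPoly (Z : Finset ℂ) (a b κ : ℝ) (γ : ℂ → ℕ → ℂ)
    (θ : EuclideanSpace ℝ (Fin 2)) : ℂ :=
  ∑ z ∈ Z, Complex.exp (z * θ 0 + height a b κ z * θ 1) *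
    jordanFactor (slope a b z) b (γ z) (θ 0) (θ 1)

theorem expPoly_linePoint (Z : Finset ℂ) {a b κ : ℝ} (hb : b ≠ 0) (γ : ℂ → ℕ → ℂ) (u t s : ℝ) :
    expPoly Z a b κ γ (linePoint a b u t s) =
      Complex.exp (s * (u ^ 2 - κ) : ℝ) * ∑ z ∈ Z, lineTerm (γ z) u t s z := by
  rw [expPoly, Finset.mul_sum]
  refine Finset.sum_congr rfl fun z _ => ?_
  rw [← exp_mul_jordanFactor_line hb (a := a)]
  simp [linePoint]

theorem continuous_expPoly (Z : Finset ℂ) (a b κ : ℝ) (γ : ℂ → ℕ → ℂ) :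
    Continuous (expPoly Z a b κ γ) := by
  unfold expPoly jordanFactor
  fun_prop

theorem analyticAt_re_expPoly (Z : Finset ℂ) (a b κ : ℝ) (γ : ℂ → ℕ → ℂ)
    (θ u : EuclideanSpace ℝ (Fin 2)) :
    AnalyticAt ℝ (fun t : ℝ => (expPoly Z a b κ γ (θ + t • u)).re) 0 := by
  let H : ℂ → ℂ := fun w => ∑ z ∈ Z,
    Complex.exp (z * (θ 0 + w * u 0) + height a b κ z * (θ 1 + w * u 1)) *
    (γ z 0 + γ z 1 * ((θ 0 + w * u 0) + slope a b z * (θ 1 + w * u 1)) +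
    γ z 2 * (((θ 0 + w * u 0) + slope a b z * (θ 1 + w * u 1)) ^ 2 / 2 + (θ 1 + w * u 1) / b) +
    γ z 3 * (((θ 0 + w * u 0) + slope a b z * (θ 1 + w * u 1)) ^ 3 / 6 +
      ((θ 0 + w * u 0) + slope a b z * (θ 1 + w * u 1)) * ((θ 1 + w * u 1) / b)))
  have hH : Differentiable ℂ H := by fun_prop
  have h1 : AnalyticAt ℝ (fun t : ℝ => (H t).re) 0 := by
    have h2 : AnalyticAt ℂ H ((0 : ℝ) : ℂ) := hH.analyticAt _
    exact h2.re_ofReal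
  refine h1.congr (Filter.Eventually.of_forall fun t => ?_)
  simp [H, expPoly, jordanFactor]

/-- Under the hypothesis on the variance function the Laplace transform is finite everywhere and a
power of an exponential sum with nonnegative coefficients. -/
theorem exists_nonneg_coefficients (μ : Measure (EuclideanSpace ℝ (Fin 2))) [IsProbabilityMeasure μ]
    (hdom : (laplaceDomain μ).Nonempty) {A a b c d e f : ℝ} (hA : A < 0) (hb : b ≠ 0)
    (hdiag : ∀ m ∈ meanDomain μ,
      varianceFunction μ m 0 0 = A * m 0 ^ 2 + a * m 0 + b * m 1 + e ∧
      varianceFunction μ m 1 1 = A * m 1 ^ 2 + c * m 0 + d * m 1 + f) :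
    laplaceDomain μ = Set.univ ∧ ∃ α : ℝ → ℝ, (∀ l ∈ realRoots A a b c d e f, 0 ≤ α l) ∧
      ∀ θ, 0 < ∑ l ∈ realRoots A a b c d e f,
          α l * Real.exp (l * θ 0 + (l ^ 2 - a * l + e * A) / b * θ 1) ∧
        laplace μ θ = (∑ l ∈ realRoots A a b c d e f,
          α l * Real.exp (l * θ 0 + (l ^ 2 - a * l + e * A) / b * θ 1)) ^ (-1 / A) := by
  obtain ⟨γ, hγ⟩ := exists_laplace_representation hb hdiag
  set Z := (complexQuartic A a b c d e f).roots.toFinset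
  have hA0 := hA.ne
  have hp : 0 < -1 / A := div_pos_of_neg_of_neg (by norm_num) hA
  have hpow : ∀ θ ∈ laplaceDomain μ, laplace μ θ =
      Real.exp (-A * cumulant μ θ) ^ (-1 / A) := by
    intro θ hθ
    rw [← Real.exp_mul]
    have : -A * cumulant μ θ * (-1 / A) = cumulant μ θ := by field_simp
    rw [this, cumulant, Real.exp_log (laplace_pos (integrable_of_mem_laplaceDomain hθ))]
  have hre : ∀ θ ∈ laplaceDomain μ, (expPoly Z a b (e * A) γ θ).re =
      Real.exp (-A * cumulant μ θ) := by
    intro θ hθ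
    rw [expPoly, ← hγ θ hθ, Complex.ofReal_re]
  -- Needed before the coefficients are studied, since that analysis lets s → ∞ along arbitrary
  -- lines.
  have huniv := laplaceDomain_eq_univ hdom hp
    (Complex.continuous_re.comp (continuous_expPoly Z a b (e * A) γ))
    (fun θ u => analyticAt_re_expPoly Z a b (e * A) γ θ u)
    (fun θ hθ => by
      simp only [Function.comp_apply]; rw [hre θ hθ]; exact Real.exp_pos _)
    (fun θ hθ => by
      simp only [Function.comp_apply]; rw [hre θ hθ]; exact hpow θ hθ)
  refine ⟨huniv, ?_⟩
  have hmem : ∀ θ, θ ∈ laplaceDomain μ := fun θ => huniv ▸ Set.mem_univ θ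
  set g : EuclideanSpace ℝ (Fin 2) → ℝ := fun θ => Real.exp (-A * cumulant μ θ) with hg
  have hgpos : ∀ θ, 0 < g θ := fun θ => Real.exp_pos _
  have hsum : ∀ u t s : ℝ, ∑ z ∈ Z, lineTerm (γ z) u t s z =
      ((Real.exp (-(s * (u ^ 2 - e * A))) * g (linePoint a b u t s) : ℝ) : ℂ) := by
    intro u t s
    have h1 := hγ _ (hmem (linePoint a b u t s))
    have h2 := expPoly_linePoint Z hb γ u t s (a := a) (κ := e * A)
    rw [expPoly, ← h1] at h2
    rw [Complex.ofReal_mul, h2, Complex.ofReal_exp, ← mul_assoc, ← Complex.exp_add]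
    simp
  have hpos : ∀ u t s : ℝ, (∑ z ∈ Z, lineTerm (γ z) u t s z).im = 0 ∧
      0 < (∑ z ∈ Z, lineTerm (γ z) u t s z).re := by
    intro u t s
    rw [hsum]
    exact ⟨Complex.ofReal_im _, by rw [Complex.ofReal_re]; exact mul_pos (Real.exp_pos _) (hgpos _)⟩
  have hgrow : ∀ u x : ℝ, Tendsto (fun s : ℝ => (∑ z ∈ Z, lineTerm (γ z) u 0 s z).re / s) atTop
      (𝓝 x) → x = 0 := by
    intro u x hx
    -- The constant in this affine functional is chosen so that its moment generating function is
    -- the power -1/A of the normalized sum on the line.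
    have hY : ∀ (s : ℝ) (y : EuclideanSpace ℝ (Fin 2)),
        Real.exp (s * ((2 * u - a) * y 0 - b * y 1 - (-1 / A) * (u ^ 2 - e * A))) =
        Real.exp (-(s * (u ^ 2 - e * A)) * (-1 / A)) * Real.exp ⟪linePoint a b u 0 s, y⟫ := by
      intro s y
      rw [← Real.exp_add, inner_linePoint]
      congr 1
      ring
    refine eq_zero_of_mgf_eq_rpow (μ := μ)
      (Y := fun y => (2 * u - a) * y 0 - b * y 1 - (-1 / A) * (u ^ 2 - e * A))
      (fun s => ?_) hp (fun s => (hpos u 0 s).2) (fun s => ?_) hx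
    · simp only [hY]
      exact (integrable_of_mem_laplaceDomain (hmem _)).const_mul _
    · simp only [mgf, hY]
      rw [integral_const_mul, hsum, Complex.ofReal_re,
        Real.mul_rpow (Real.exp_pos _).le (hgpos _).le, ← hpow _ (hmem _), Real.exp_mul, laplace]
  have him := coeff_eq_zero_of_im_ne_zero (fun z hz => conj_mem_roots_complexQuartic hz) hpos
  have hreal := coeff_nonneg_of_im_eq_zero him hpos hgrow
  have hval : ∀ θ, g θ = ∑ l ∈ realRoots A a b c d e f,
      (γ l 0).re * Real.exp (l * θ 0 + (l ^ 2 - a * l + e * A) / b * θ 1) := by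
    intro θ
    rw [← Complex.ofReal_inj, hg, hγ θ (hmem θ), Complex.ofReal_sum]
    symm
    rw [← Finset.sum_subset (s₁ := (realRoots A a b c d e f).map
      ⟨((↑) : ℝ → ℂ), Complex.ofReal_injective⟩), Finset.sum_map]
    · refine Finset.sum_congr rfl fun l hl => ?_
      obtain ⟨h1, h2, h3, h4, -⟩ := hreal l (ofReal_mem_roots_complexQuartic.2 hl)
        (Complex.ofReal_im l)
      have h5 : γ l 0 = ((γ l 0).re : ℂ) := Complex.ext (by simp) (by simp [h4])
      simp only [Function.Embedding.coeFn_mk]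
      rw [jordanFactor, h1, h2, h3]
      conv_rhs => rw [h5]
      rw [height]
      push_cast
      ring
    · intro z hz
      obtain ⟨l, hl, rfl⟩ := Finset.mem_map.1 hz
      exact ofReal_mem_roots_complexQuartic.2 hl
    · intro z hz hnot
      have hzim : z.im ≠ 0 := fun h => hnot (Finset.mem_map.2 ⟨z.re, by
        rw [← ofReal_mem_roots_complexQuartic]
        rwa [show (z.re : ℂ) = z from Complex.ext (by simp) (by simp [h])],
        Complex.ext (by simp) (by simp [h])⟩)
      have := him z hz hzim
      simp [jordanFactor, this 0, this 1, this 2, this 3]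
  refine ⟨fun l => (γ l 0).re, fun l hl => ?_, fun θ => ?_⟩
  · exact (hreal l (ofReal_mem_roots_complexQuartic.2 hl) (Complex.ofReal_im l)).2.2.2.2
  · rw [← hval]
    exact ⟨hgpos θ, hpow θ (hmem θ)⟩

end Coefficients

end NEF

namespace NEF

open Set Filter Topology ProbabilityTheory

/-! ### Integrality of the exponent. -/

section Integrality

variable {Ω : Type*} [MeasurableSpace Ω] {ν : Measure Ω} {X : Ω → ℝ}

/-- A power of a sum of two exponentials is a moment generating function only if the exponent is a
natural number: the complex moment generating function is entire. -/
theorem exists_nat_of_mgf_eq_rpow (hint : ∀ t, Integrable (fun ω => Real.exp (t * X ω)) ν)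
    {p α₁ α₂ l₁ l₂ : ℝ} (h₁ : 0 < α₁) (h₂ : 0 < α₂) (hl : l₁ ≠ l₂)
    (hmgf : ∀ t, mgf X ν t = (α₁ * Real.exp (l₁ * t) + α₂ * Real.exp (l₂ * t)) ^ p) :
    ∃ N : ℕ, p = N := by
  have hset : integrableExpSet X ν = Set.univ := Set.eq_univ_of_forall hint
  have hM : ∀ z, DifferentiableAt ℂ (complexMGF X ν) z := fun z =>
    (hasDerivAt_complexMGF (by rw [hset, interior_univ]; trivial)).differentiableAt
  have hMd : Differentiable ℂ (complexMGF X ν) := hM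
  set M := complexMGF X ν with hMdef
  set h : ℂ → ℂ := fun z => α₁ * Complex.exp (l₁ * z) + α₂ * Complex.exp (l₂ * z) with hh
  have hhd : Differentiable ℂ h := by fun_prop
  have hM' : Differentiable ℂ (deriv M) := hMd.contDiff.differentiable_deriv_two
  have hh' : Differentiable ℂ (deriv h) := hhd.contDiff.differentiable_deriv_two
  have hderiv : ∀ z,
      deriv h z = α₁ * l₁ * Complex.exp (l₁ * z) + α₂ * l₂ * Complex.exp (l₂ * z) := by
    intro z
    have e : ∀ l : ℂ, HasDerivAt (fun w => Complex.exp (l * w)) (Complex.exp (l * z) * l) z := by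
      intro l
      simpa using ((hasDerivAt_id z).const_mul l).cexp
    have e' : HasDerivAt h _ z := ((e l₁).const_mul (α₁ : ℂ)).add ((e l₂).const_mul (α₂ : ℂ))
    rw [e'.deriv]
    ring
  -- The relation M = h^p becomes M'h = p h'M, which contains no power and so extends from the real
  -- axis to ℂ by the identity theorem.
  have hode_real : ∀ t : ℝ, deriv M t * h t = p * deriv h t * M t := by
    intro t
    have hr : HasDerivAt (fun t : ℝ => α₁ * Real.exp (l₁ * t) + α₂ * Real.exp (l₂ * t))
        (α₁ * (Real.exp (l₁ * t) * l₁) + α₂ * (Real.exp (l₂ * t) * l₂)) t := by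
      have e : ∀ l : ℝ, HasDerivAt (fun w => Real.exp (l * w)) (Real.exp (l * t) * l) t := by
        intro l
        simpa using ((hasDerivAt_id t).const_mul l).exp
      exact ((e l₁).const_mul α₁).add ((e l₂).const_mul α₂)
    have hpos : 0 < α₁ * Real.exp (l₁ * t) + α₂ * Real.exp (l₂ * t) := by positivity
    have d1 := (hr.rpow_const (p := p) (Or.inl hpos.ne')).ofReal_comp
    have d2 : HasDerivAt (fun t : ℝ => M t) (deriv M t) t := (hM t).hasDerivAt.comp_ofReal
    have e1 : (fun t : ℝ => M t) = fun t : ℝ =>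
        (((α₁ * Real.exp (l₁ * t) + α₂ * Real.exp (l₂ * t)) ^ p : ℝ) : ℂ) := by
      ext t
      rw [hMdef, complexMGF_ofReal, hmgf]
    rw [e1] at d2
    have e2 : M t = _ := congrFun e1 t
    have e3 : h t = ((α₁ * Real.exp (l₁ * t) + α₂ * Real.exp (l₂ * t) : ℝ) : ℂ) := by
      simp [hh]
    have e4 : deriv h t =
        ((α₁ * (Real.exp (l₁ * t) * l₁) + α₂ * (Real.exp (l₂ * t) * l₂) : ℝ) : ℂ) := by
      rw [hderiv]; push_cast; ring
    rw [d2.unique d1, e2, e3, e4]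
    norm_cast
    rw [Real.rpow_sub_one hpos.ne']
    field_simp
  have hfreq : ∀ P : ℂ → Prop, (∀ t : ℝ, P t) → ∃ᶠ z in 𝓝[≠] (0 : ℂ), P z := by
    intro P hP
    have ht : Tendsto ((↑) : ℝ → ℂ) (𝓝[≠] 0) (𝓝[≠] 0) := by
      refine tendsto_nhdsWithin_of_tendsto_nhds_of_eventually_within _ ?_ ?_
      · exact (Complex.continuous_ofReal.tendsto' 0 0 (by simp)).mono_left nhdsWithin_le_nhds
      · filter_upwards [self_mem_nhdsWithin] with t ht
        simpa using ht
    exact ht.frequently (Eventually.frequently (Filter.Eventually.of_forall hP))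
  have hode : ∀ z, deriv M z * h z = p * deriv h z * M z := by
    have a1 : AnalyticOnNhd ℂ (fun z => deriv M z * h z) Set.univ := fun z _ =>
      (hM'.mul hhd).analyticAt z
    have a2 : AnalyticOnNhd ℂ (fun z => p * deriv h z * M z) Set.univ := fun z _ =>
      ((hh'.const_mul (p : ℂ)).mul hMd).analyticAt z
    intro z
    exact congrFun (a1.eq_of_frequently_eq a2 (hfreq _ hode_real)) z
  have hl' : (l₂ : ℂ) - l₁ ≠ 0 := by
    rw [← Complex.ofReal_sub]; exact Complex.ofReal_ne_zero.2 (sub_ne_zero.2 hl.symm)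
  have hα₁ : (α₁ : ℂ) ≠ 0 := Complex.ofReal_ne_zero.2 h₁.ne'
  have hα₂ : (α₂ : ℂ) ≠ 0 := Complex.ofReal_ne_zero.2 h₂.ne'
  obtain ⟨z₀, hz₀⟩ : ∃ z₀ : ℂ,
      (α₂ : ℂ) * Complex.exp (l₂ * z₀) = -(α₁ * Complex.exp (l₁ * z₀)) := by
    refine ⟨Complex.log (-α₁ / α₂) / (l₂ - l₁), ?_⟩
    set z₀ := Complex.log (-α₁ / α₂) / (l₂ - l₁) with hz
    have e1 : Complex.exp ((l₂ - l₁) * z₀) = -α₁ / α₂ := by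
      rw [hz, mul_div_cancel₀ _ hl',
        Complex.exp_log (div_ne_zero (neg_ne_zero.2 hα₁) hα₂)]
    have e2 : (l₂ : ℂ) * z₀ = (l₂ - l₁) * z₀ + l₁ * z₀ := by ring
    rw [e2, Complex.exp_add, e1]
    field_simp
  have hh0 : h z₀ = 0 := by simp only [hh]; rw [hz₀]; ring
  have hd0 : deriv h z₀ ≠ 0 := by
    have : deriv h z₀ = -((l₂ - l₁) * (α₁ * Complex.exp (l₁ * z₀))) := by
      rw [hderiv]
      linear_combination (l₂ : ℂ) * hz₀
    rw [this]
    exact neg_ne_zero.2 (mul_ne_zero hl' (mul_ne_zero hα₁ (Complex.exp_ne_zero _)))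
  have hMnz : ¬ ∀ᶠ z in 𝓝 z₀, M z = 0 := by
    intro hz
    have hM0 : M = fun _ => 0 := AnalyticOnNhd.eq_of_eventuallyEq (fun z _ => hMd.analyticAt z)
      (fun z _ => analyticAt_const) hz
    have := congrFun hM0 ((0 : ℝ) : ℂ)
    rw [hMdef, complexMGF_ofReal, hmgf, Complex.ofReal_eq_zero] at this
    exact (Real.rpow_pos_of_pos (by positivity) p).ne' this
  obtain ⟨n, G, hGa, hG0, hG⟩ :=
    (hMd.analyticAt z₀).exists_eventuallyEq_pow_smul_nonzero_iff.2 hMnz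
  -- Write M = (z - z₀)^n G and factor z - z₀ out of h, then cancel (z - z₀)^n. As z → z₀ this
  -- leaves n G h' = p h' G at the simple zero z₀.
  have hev : ∀ᶠ z in 𝓝[≠] z₀, (n * G z + (z - z₀) * deriv G z) * dslope h z₀ z =
      p * deriv h z * G z := by
    have h1 : ∀ᶠ z in 𝓝 z₀,
        deriv M z = n * (z - z₀) ^ (n - 1) * G z + (z - z₀) ^ n * deriv G z := by
      filter_upwards [hG.eventually_nhds, hGa.eventually_analyticAt] with z hz hza
      have h2 : HasDerivAt (fun w => (w - z₀) ^ n * G w)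
          (n * (z - z₀) ^ (n - 1) * 1 * G z + (z - z₀) ^ n * deriv G z) z :=
        (((hasDerivAt_id z).sub_const z₀).pow n).mul hza.differentiableAt.hasDerivAt
      have h3 : M =ᶠ[𝓝 z] fun w => (w - z₀) ^ n * G w := hz
      rw [h3.deriv_eq, h2.deriv, mul_one]
    filter_upwards [nhdsWithin_le_nhds h1, nhdsWithin_le_nhds hG, self_mem_nhdsWithin]
      with z hz1 hz2 hz3
    have hne : z - z₀ ≠ 0 := sub_ne_zero.2 hz3
    have h4 : h z = (z - z₀) * dslope h z₀ z := by
      rw [← smul_eq_mul, sub_smul_dslope, hh0, sub_zero]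
    have h5 := hode z
    rw [hz1, hz2, h4, smul_eq_mul] at h5
    have h6 : (z - z₀) * (n * (z - z₀) ^ (n - 1)) = n * (z - z₀) ^ n := by
      -- For n = 0 the truncated exponent n - 1 is harmless, because the factor n vanishes.
      rcases Nat.eq_zero_or_pos n with hn | hn
      · simp [hn]
      · rw [← Nat.sub_add_cancel hn, Nat.add_sub_cancel, pow_succ]; ring
    refine mul_left_cancel₀ (pow_ne_zero n hne) ?_
    linear_combination h5 - G z * dslope h z₀ z * h6
  have hc1 : ContinuousAt (fun z => (n * G z + (z - z₀) * deriv G z) * dslope h z₀ z) z₀ := by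
    have b1 : ContinuousAt (dslope h z₀) z₀ := continuousAt_dslope_same.2 (hhd z₀)
    have b2 := hGa.continuousAt
    have b3 := hGa.deriv.continuousAt
    fun_prop
  have hc2 : ContinuousAt (fun z => p * deriv h z * G z) z₀ := by
    have b2 := hGa.continuousAt
    have b3 : ContinuousAt (deriv h) z₀ := hh'.continuous.continuousAt
    fun_prop
  have hfin := tendsto_nhds_unique_of_eventuallyEq (hc1.tendsto.mono_left nhdsWithin_le_nhds)
    (hc2.tendsto.mono_left nhdsWithin_le_nhds) hev
  rw [sub_self, zero_mul, add_zero, dslope_same] at hfin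
  refine ⟨n, ?_⟩
  have : (p : ℂ) = n := by
    refine mul_right_cancel₀ (mul_ne_zero hd0 hG0) ?_
    linear_combination -hfin
  exact_mod_cast this

end Integrality

/-! ### Recognizing a point mass. -/

section Dirac

/-- A probability measure with the Laplace transform of a point mass is a point mass. -/
theorem eq_dirac_of_laplace_eq_exp {n : ℕ} {μ : Measure (EuclideanSpace ℝ (Fin n))}
    [IsProbabilityMeasure μ] (hint : ∀ θ, Integrable (fun x => Real.exp ⟪θ, x⟫) μ)
    {v : EuclideanSpace ℝ (Fin n)} (hL : ∀ θ, laplace μ θ = Real.exp ⟪θ, v⟫) :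
    μ = Measure.dirac v := by
  have hae : ∀ i, ∀ᵐ x ∂μ, x i = v i := by
    intro i
    set u : EuclideanSpace ℝ (Fin n) := EuclideanSpace.single i 1 with hu
    have hui : ∀ x : EuclideanSpace ℝ (Fin n), ⟪u, x⟫ = x i := fun x => by
      rw [hu, EuclideanSpace.inner_single_left]; simp
    have h1 : ∀ θ : EuclideanSpace ℝ (Fin n),
        Integrable (fun x => Real.exp (-⟪θ, v⟫) * Real.exp ⟪θ, x⟫) μ ∧
        ∫ x, Real.exp (-⟪θ, v⟫) * Real.exp ⟪θ, x⟫ ∂μ = 1 := fun θ => by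
      refine ⟨(hint θ).const_mul _, ?_⟩
      rw [integral_const_mul]
      change _ * laplace μ θ = 1
      rw [hL, ← Real.exp_add, neg_add_cancel, Real.exp_zero]
    -- The hypothesis gives cosh(xᵢ - vᵢ) mean 1, while cosh ≥ 1 with equality only at 0.
    have h2 : ∀ y : ℝ, 0 ≤ Real.exp y + Real.exp (-y) - 2 := fun y => by
      have := Real.one_le_cosh y
      rw [Real.cosh_eq] at this
      linarith
    have e1 : ∀ x : EuclideanSpace ℝ (Fin n), Real.exp (x i - v i) + Real.exp (-(x i - v i)) - 2 =
        Real.exp (-⟪u, v⟫) * Real.exp ⟪u, x⟫ + Real.exp (-⟪-u, v⟫) * Real.exp ⟪-u, x⟫ - 2 := by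
      intro x
      rw [← Real.exp_add, ← Real.exp_add, inner_neg_left, inner_neg_left, hui, hui]
      ring_nf
    have h3 : ∫ x, (Real.exp (x i - v i) + Real.exp (-(x i - v i)) - 2) ∂μ = 0 := by
      simp only [e1]
      have k := (h1 u).1.add (h1 (-u)).1
      simp only [Pi.add_def] at k
      rw [integral_sub k (integrable_const _), integral_add (h1 u).1 (h1 (-u)).1, (h1 u).2,
        (h1 (-u)).2]
      simp
      norm_num
    have hI : Integrable (fun x : EuclideanSpace ℝ (Fin n) =>
        Real.exp (x i - v i) + Real.exp (-(x i - v i)) - 2) μ := by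
      simp only [e1]
      exact ((h1 u).1.add (h1 (-u)).1).sub (integrable_const _)
    have h4 := (integral_eq_zero_iff_of_nonneg (fun x => h2 _) hI).1 h3
    filter_upwards [h4] with x hx
    simp only [Pi.zero_apply] at hx
    by_contra hne
    have := (Real.one_lt_cosh (x := x i - v i)).2 (sub_ne_zero.2 hne)
    rw [Real.cosh_eq] at this
    linarith
  have h5 : (fun x => x) =ᵐ[μ] fun _ => v := by
    filter_upwards [ae_all_iff.2 hae] with x hx
    ext i
    exact hx i
  calc μ = μ.map (fun x => x) := Measure.map_id'.symm
    _ = μ.map (fun _ => v) := Measure.map_congr h5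
    _ = Measure.dirac v := by simp

end Dirac

/-! ### Exponential sums on the parabola and the faces of the measure. -/

section ExponentialSums

/-- The exponential sum with frequencies on the parabola. -/
noncomputable def realExpSum (R : Finset ℝ) (a b κ : ℝ) (α : ℝ → ℝ)
    (θ : EuclideanSpace ℝ (Fin 2)) : ℝ :=
  ∑ l ∈ R, α l * Real.exp (l * θ 0 + (l ^ 2 - a * l + κ) / b * θ 1)

variable {R : Finset ℝ} {a b κ : ℝ} {α : ℝ → ℝ}

theorem realExpSum_linePoint (hb : b ≠ 0) (u t s m : ℝ) :
    Real.exp (-(s * (u ^ 2 - κ - m))) * realExpSum R a b κ α (linePoint a b u t s) =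
      ∑ l ∈ R, α l * Real.exp (l * t + s * (m - (l - u) ^ 2)) := by
  rw [realExpSum, Finset.mul_sum]
  refine Finset.sum_congr rfl fun l _ => ?_
  rw [mul_left_comm, ← Real.exp_add]
  congr 2
  simp only [linePoint, PiLp.toLp_apply, Matrix.cons_val_zero, Matrix.cons_val_one]
  field_simp
  ring

theorem tendsto_sum_exp {u t m : ℝ} (P : ℝ → Prop) [DecidablePred P]
    (hP : ∀ l ∈ R, P l → (l - u) ^ 2 = m) (hnP : ∀ l ∈ R, ¬ P l → α l = 0 ∨ m < (l - u) ^ 2) :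
    Tendsto (fun s : ℝ => ∑ l ∈ R, α l * Real.exp (l * t + s * (m - (l - u) ^ 2))) atTop
      (𝓝 (∑ l ∈ R with P l, α l * Real.exp (l * t))) := by
  rw [Finset.sum_filter]
  refine tendsto_finsetSum _ fun l hl => ?_
  by_cases h : P l
  · simp [h, hP l hl h]
  · rw [if_neg h]
    rcases hnP l hl h with h0 | h0
    · simp [h0]
    · have h1 : Tendsto (fun s : ℝ => Real.exp (l * t + s * (m - (l - u) ^ 2))) atTop (𝓝 0) :=
        Real.tendsto_exp_atBot.comp (tendsto_atBot_add_const_left _ _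
          (tendsto_id.atTop_mul_const_of_neg (by linarith)))
      simpa using h1.const_mul (α l)

theorem continuous_realExpSum : Continuous (realExpSum R a b κ α) := by
  unfold realExpSum
  fun_prop

/-- Frequencies on a strictly convex curve are exposed, so positivity of the sum forces
nonnegativity of its coefficients. -/
theorem coeff_nonneg_of_realExpSum_pos (hb : b ≠ 0) (h : ∀ θ, 0 < realExpSum R a b κ α θ) :
    ∀ l ∈ R, 0 ≤ α l := by
  intro l₀ hl₀
  have h1 := tendsto_sum_exp (α := α) (u := l₀) (t := 0) (m := 0) (R := R) (fun l => l = l₀)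
    (fun l _ hl => by rw [hl]; ring)
    (fun l _ hl => Or.inr (by have := sub_ne_zero.2 hl; positivity))
  rw [Finset.filter_eq', if_pos hl₀, Finset.sum_singleton, mul_zero, Real.exp_zero, mul_one] at h1
  refine ge_of_tendsto' h1 fun s => ?_
  rw [← realExpSum_linePoint hb (a := a) (κ := κ)]
  exact (mul_pos (Real.exp_pos _) (h _)).le

/-- If a power of an exponential sum with at least two positive coefficients is a Laplace transform
then the exponent is a natural number. -/
theorem exists_nat_of_laplace_eq_rpow {μ : Measure (EuclideanSpace ℝ (Fin 2))}
    [IsProbabilityMeasure μ] (hint : ∀ θ, Integrable (fun x => Real.exp ⟪θ, x⟫) μ) (hb : b ≠ 0)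
    {p : ℝ} (hp : 0 < p) (hpos : ∀ θ, 0 < realExpSum R a b κ α θ)
    (hL : ∀ θ, laplace μ θ = realExpSum R a b κ α θ ^ p) {l₁ l₂ : ℝ} (hl₁ : l₁ ∈ R) (hl₂ : l₂ ∈ R)
    (hlt : l₁ < l₂) (hα₁ : 0 < α l₁) (hα₂ : 0 < α l₂)
    (hcons : ∀ l ∈ R, ¬ (l = l₁ ∨ l = l₂) → α l = 0 ∨ l < l₁ ∨ l₂ < l) : ∃ N : ℕ, p = N := by
  classical
  -- Midpoint and squared half distance: m - (l - u)² is zero at l₁ and l₂ and negative outside [l₁,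
  -- l₂], so only these two terms survive as s → ∞.
  set u := (l₁ + l₂) / 2 with hu
  set m := ((l₂ - l₁) / 2) ^ 2 with hm
  set Y : EuclideanSpace ℝ (Fin 2) → ℝ := fun x =>
    (2 * u - a) * x 0 - b * x 1 - p * (u ^ 2 - κ - m) with hY
  have hYm : Measurable Y := by fun_prop
  have hexp : ∀ t s x, Real.exp (t * x 0 + s * Y x) =
      Real.exp (-(s * (u ^ 2 - κ - m)) * p) * Real.exp ⟪linePoint a b u t s, x⟫ := by
    intro t s x
    rw [← Real.exp_add, inner_linePoint, hY]
    congr 1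
    ring
  have hI : ∀ t s, Integrable (fun x => Real.exp (t * x 0 + s * Y x)) μ := by
    intro t s
    simp only [hexp]
    exact (hint _).const_mul _
  have hval : ∀ t s, ∫ x, Real.exp (t * x 0 + s * Y x) ∂μ =
      (∑ l ∈ R, α l * Real.exp (l * t + s * (m - (l - u) ^ 2))) ^ p := by
    intro t s
    simp only [hexp]
    rw [integral_const_mul, ← realExpSum_linePoint hb (a := a) (κ := κ),
      Real.mul_rpow (Real.exp_pos _).le (hpos _).le, ← hL, Real.exp_mul, laplace]
  have hlim : ∀ t, Tendsto (fun s => ∫ x, Real.exp (t * x 0 + s * Y x) ∂μ) atTop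
      (𝓝 ((α l₁ * Real.exp (l₁ * t) + α l₂ * Real.exp (l₂ * t)) ^ p)) := by
    intro t
    have h1 := tendsto_sum_exp (α := α) (u := u) (t := t) (m := m) (R := R)
      (fun l => l = l₁ ∨ l = l₂)
      (by rintro l _ (rfl | rfl) <;> rw [hu, hm] <;> ring)
      (fun l hl hn => by
        rcases hcons l hl hn with h | h | h
        · exact Or.inl h
        · right; rw [hu, hm]; nlinarith
        · right; rw [hu, hm]; nlinarith)
    have hfil : R.filter (fun l => l = l₁ ∨ l = l₂) = {l₁, l₂} := by
      ext l
      simp only [Finset.mem_filter, Finset.mem_insert, Finset.mem_singleton]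
      constructor
      · exact fun h => h.2
      · rintro (h | h)
        · exact ⟨h ▸ hl₁, Or.inl h⟩
        · exact ⟨h ▸ hl₂, Or.inr h⟩
    rw [hfil, Finset.sum_pair hlt.ne] at h1
    simp only [hval]
    exact h1.rpow_const (Or.inr hp.le)
  have hYae : ∀ᵐ x ∂μ, Y x ≤ 0 := by
    refine ae_nonpos_of_tendsto_mgf (fun s => by simpa using hI 0 s) fun ε hε => ?_
    have h1 : Tendsto (fun s : ℝ => Real.exp (-ε * s)) atTop (𝓝 0) := by
      simpa using tendsto_pow_mul_exp_neg_mul hε 0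
    have h2 := h1.mul (hlim 0)
    rw [zero_mul] at h2
    simpa [mgf] using h2
  have hms : MeasurableSet {x | Y x = 0} := hYm (measurableSet_singleton 0)
  -- As Y ≤ 0, the weights exp(sY) decrease to the indicator of Y = 0; the limit thus belongs to μ
  -- restricted to the face.
  have hmgf : ∀ t, mgf (fun x : EuclideanSpace ℝ (Fin 2) => x 0) (μ.restrict {x | Y x = 0}) t =
      (α l₁ * Real.exp (l₁ * t) + α l₂ * Real.exp (l₂ * t)) ^ p := by
    intro t
    refine tendsto_nhds_unique ?_ (hlim t)
    rw [mgf, ← integral_indicator hms]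
    refine tendsto_integral_filter_of_dominated_convergence
      (fun x => Real.exp (t * x 0 + 0 * Y x))
      (Filter.Eventually.of_forall fun s => (hI t s).aestronglyMeasurable) ?_ (hI t 0) ?_
    · filter_upwards [eventually_ge_atTop 0] with s hs
      filter_upwards [hYae] with x hx
      rw [Real.norm_of_nonneg (Real.exp_pos _).le, zero_mul]
      exact Real.exp_le_exp.2 (add_le_add_right (mul_nonpos_of_nonneg_of_nonpos hs hx) _)
    · filter_upwards [hYae] with x hx
      by_cases h0 : Y x = 0
      · simp [h0]
      · have hneg : Y x < 0 := lt_of_le_of_ne hx h0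
        simp only [Set.indicator_apply, Set.mem_ofPred_eq, h0, if_false]
        exact Real.tendsto_exp_atBot.comp (tendsto_atBot_add_const_left _ _
          (tendsto_id.atTop_mul_const_of_neg hneg))
  refine exists_nat_of_mgf_eq_rpow (fun t => ?_) hα₁ hα₂ hlt.ne hmgf
  have := (hI t 0).restrict (s := {x | Y x = 0})
  simpa using this

/-- If a power of an exponential sum with nonnegative coefficients is the Laplace transform of a
probability measure which is not a point mass, at least two coefficients are positive. -/
theorem exists_consecutive_frequencies {μ : Measure (EuclideanSpace ℝ (Fin 2))}
    [IsProbabilityMeasure μ] (hpoint : ∀ x, μ ≠ Measure.dirac x)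
    (hint : ∀ θ, Integrable (fun x => Real.exp ⟪θ, x⟫) μ)
    {p : ℝ} (hα : ∀ l ∈ R, 0 ≤ α l) (hpos : ∀ θ, 0 < realExpSum R a b κ α θ)
    (hL : ∀ θ, laplace μ θ = realExpSum R a b κ α θ ^ p) :
    ∃ l₁ ∈ R, ∃ l₂ ∈ R, l₁ < l₂ ∧ 0 < α l₁ ∧ 0 < α l₂ ∧
      ∀ l ∈ R, ¬ (l = l₁ ∨ l = l₂) → α l = 0 ∨ l < l₁ ∨ l₂ < l := by
  classical
  set N := R.filter fun l => α l ≠ 0 with hN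
  have hNne : N.Nonempty := by
    by_contra hemp
    rw [Finset.not_nonempty_iff_eq_empty, hN, Finset.filter_eq_empty_iff] at hemp
    have := hpos 0
    rw [realExpSum, Finset.sum_eq_zero (fun l hl => by
      rw [not_not.1 (hemp hl), zero_mul])] at this
    exact lt_irrefl _ this
  set l₁ := N.min' hNne with hl₁
  have hl₁N : l₁ ∈ N := N.min'_mem hNne
  have hl₁R : l₁ ∈ R := (Finset.mem_filter.1 hl₁N).1
  have hNe : (N.erase l₁).Nonempty := by
    by_contra hemp
    rw [Finset.not_nonempty_iff_eq_empty] at hemp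
    have hsum : ∀ θ, realExpSum R a b κ α θ =
        α l₁ * Real.exp (l₁ * θ 0 + (l₁ ^ 2 - a * l₁ + κ) / b * θ 1) := by
      intro θ
      refine Finset.sum_eq_single_of_mem l₁ hl₁R fun l hl hne => ?_
      have : α l = 0 := by
        by_contra h0
        have : l ∈ N.erase l₁ := Finset.mem_erase.2 ⟨hne, Finset.mem_filter.2 ⟨hl, h0⟩⟩
        rw [hemp] at this
        simp at this
      rw [this, zero_mul]
    have hL0 : laplace μ 0 = 1 := by simp [laplace]
    have hα1 : 0 ≤ α l₁ := hα l₁ hl₁R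
    have hαp : α l₁ ^ p = 1 := by
      rw [← hL0, hL, hsum]; simp
    -- A single frequency makes L a pure exponential, so μ would sit at p times that frequency
    -- vector.
    refine hpoint (!₂[p * l₁, p * ((l₁ ^ 2 - a * l₁ + κ) / b)])
      (eq_dirac_of_laplace_eq_exp hint fun θ => ?_)
    rw [hL, hsum, Real.mul_rpow hα1 (Real.exp_pos _).le, hαp, one_mul, ← Real.exp_mul]
    congr 1
    simp [PiLp.inner_apply, Fin.sum_univ_two]
    ring
  set l₂ := (N.erase l₁).min' hNe with hl₂
  have hl₂N : l₂ ∈ N.erase l₁ := Finset.min'_mem _ hNe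
  have hl₂R : l₂ ∈ R := (Finset.mem_filter.1 (Finset.mem_of_mem_erase hl₂N)).1
  refine ⟨l₁, hl₁R, l₂, hl₂R, ?_, ?_, ?_, fun l hl hn => ?_⟩
  · exact lt_of_le_of_ne (N.min'_le _ (Finset.mem_of_mem_erase hl₂N))
      (Finset.ne_of_mem_erase hl₂N).symm
  · exact (hα l₁ hl₁R).lt_of_ne' (Finset.mem_filter.1 hl₁N).2
  · exact (hα l₂ hl₂R).lt_of_ne' (Finset.mem_filter.1 (Finset.mem_of_mem_erase hl₂N)).2
  · by_cases h0 : α l = 0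
    · exact Or.inl h0
    · push Not at hn
      exact Or.inr (Or.inr (lt_of_le_of_ne ((N.erase l₁).min'_le _
        (Finset.mem_erase.2 ⟨hn.1, Finset.mem_filter.2 ⟨hl, h0⟩⟩)) hn.2.symm))

end ExponentialSums

end NEF

/-! ### Sign and parity for arbitrary admissible coefficients. -/

theorem theorem2p2
    (μ : Measure (EuclideanSpace ℝ (Fin 2))) [IsProbabilityMeasure μ]
    (hpoint : ∀ x, μ ≠ Measure.dirac x)
    (hdom : (NEF.laplaceDomain μ).Nonempty)
    (A a b c d e f : ℝ) (hA : A < 0) (hb : b ≠ 0)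
    (hdiag : ∀ m ∈ NEF.meanDomain μ,
      NEF.varianceFunction μ m 0 0 = A * m 0 ^ 2 + a * m 0 + b * m 1 + e ∧
      NEF.varianceFunction μ m 1 1 = A * m 1 ^ 2 + c * m 0 + d * m 1 + f) :
    2 ≤ (NEF.realRoots A a b c d e f).card ∧
    (∃ α : ℝ → ℝ, NEF.HasLaplaceForm μ A a b c d e f α) ∧
    ∀ α : ℝ → ℝ, NEF.HasLaplaceForm μ A a b c d e f α →
      ((∀ l ∈ NEF.realRoots A a b c d e f, 0 ≤ α l) ∧
        ∑ l ∈ NEF.realRoots A a b c d e f, α l = 1 ∧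
        (∃ N : ℕ, -1 / A = N) ∧
        NEF.laplaceDomain μ = Set.univ) ∨
      ((∀ l ∈ NEF.realRoots A a b c d e f, α l ≤ 0) ∧
        ∑ l ∈ NEF.realRoots A a b c d e f, α l = -1 ∧
        (∃ N : ℕ, -1 / A = 2 * N) ∧
        NEF.laplaceDomain μ = Set.univ) := by
  have hA0 := hA.ne
  have hp : 0 < -1 / A := div_pos_of_neg_of_neg (by norm_num) hA
  obtain ⟨huniv, α, hα, hform⟩ := NEF.exists_nonneg_coefficients μ hdom hA hb hdiag
  have hmem : ∀ θ, θ ∈ NEF.laplaceDomain μ := fun θ => huniv ▸ Set.mem_univ θ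
  have hint := fun θ => NEF.integrable_of_mem_laplaceDomain (hmem θ)
  obtain ⟨l₁, hl₁, l₂, hl₂, hlt, hα₁, hα₂, hcons⟩ :=
    NEF.exists_consecutive_frequencies (R := NEF.realRoots A a b c d e f) (a := a) (b := b)
      (κ := e * A) hpoint hint hα (fun θ => (hform θ).1) (fun θ => (hform θ).2)
  obtain ⟨N, hN⟩ := NEF.exists_nat_of_laplace_eq_rpow (R := NEF.realRoots A a b c d e f) (a := a)
    (κ := e * A) hint hb hp (fun θ => (hform θ).1) (fun θ => (hform θ).2) hl₁ hl₂ hlt hα₁ hα₂ hcons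
  refine ⟨Finset.one_lt_card.2 ⟨l₁, hl₁, l₂, hl₂, hlt.ne⟩, ⟨α, fun θ _ => (hform θ).2⟩,
    fun β hβ => ?_⟩
  have hN0 : N ≠ 0 := by
    rintro rfl
    rw [Nat.cast_zero] at hN
    exact hp.ne' hN
  set S := NEF.realExpSum (NEF.realRoots A a b c d e f) a b (e * A) β with hS
  -- With -1/A already known to be a natural number, the real power is an ordinary one even for a
  -- negative base. Hence S, continuous and without zeros, may have either constant sign.
  have hL : ∀ θ, NEF.laplace μ θ = S θ ^ N := fun θ => by
    rw [hβ θ (hmem θ), hN, Real.rpow_natCast]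
    rfl
  have hSne : ∀ θ, S θ ≠ 0 := fun θ h0 => by
    have := NEF.laplace_pos (hint θ)
    rw [hL, h0, zero_pow hN0] at this
    exact lt_irrefl _ this
  have hScont : Continuous S := NEF.continuous_realExpSum
  have hS0 : S 0 = ∑ l ∈ NEF.realRoots A a b c d e f, β l := by
    simp [hS, NEF.realExpSum]
  have hS0N : S 0 ^ N = 1 := by
    rw [← hL]; simp [NEF.laplace]
  rcases (hSne 0).lt_or_gt with hneg | hpos
  · right
    have hall : ∀ θ, S θ < 0 := by
      intro θ
      by_contra h
      obtain ⟨η, hη⟩ := mem_range_of_exists_le_of_exists_ge hScont ⟨0, hneg.le⟩ ⟨θ, not_lt.1 h⟩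
      exact hSne η hη
    have heven : Even N := by
      by_contra hodd
      have := (Nat.not_even_iff_odd.1 hodd).pow_neg hneg
      rw [hS0N] at this
      linarith
    refine ⟨fun l hl => ?_, ?_, ?_, huniv⟩
    -- The positive sum is -S, with coefficients `-β l`.
    · have := NEF.coeff_nonneg_of_realExpSum_pos (R := NEF.realRoots A a b c d e f) (a := a)
        (κ := e * A) (α := fun l => -β l) hb (fun θ => by
          have h1 : NEF.realExpSum (NEF.realRoots A a b c d e f) a b (e * A) (fun l => -β l) θ =
              -S θ := by
            simp [hS, NEF.realExpSum]
          rw [h1]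
          exact neg_pos.2 (hall θ)) l hl
      linarith
    · rw [← hS0]
      have h1 : (-S 0) ^ N = 1 := by rw [heven.neg_pow, hS0N]
      have h2 := (pow_eq_one_iff_of_nonneg (neg_pos.2 hneg).le hN0).1 h1
      linarith
    · obtain ⟨M, hM⟩ := heven
      exact ⟨M, by rw [hN, hM]; push_cast; ring⟩
  · left
    have hall : ∀ θ, 0 < S θ := by
      intro θ
      by_contra h
      obtain ⟨η, hη⟩ := mem_range_of_exists_le_of_exists_ge hScont ⟨θ, not_lt.1 h⟩ ⟨0, hpos.le⟩
      exact hSne η hη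
    refine ⟨NEF.coeff_nonneg_of_realExpSum_pos hb hall, ?_, ⟨N, hN⟩, huniv⟩
    rw [← hS0]
    exact (pow_eq_one_iff_of_nonneg hpos.le hN0).1 hS0N
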